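/- **Setting.** Let $p,r,n\ge 0$ and $d\ge 1$ be integers, let $s:\mathbb R^r\to\mathbb R^r$ be locally Lipschitz, and let $y_{\rm r}:\mathbb R^r\to\mathbb R$, $f:\mathbb R^n\times\mathbb R\times\mathbb R^p\to\mathbb R^n$, $q:\mathbb R^n\times\mathbb R\times\mathbb R^p\to\mathbb R$ be $C^1$. The exosystem is $\dot w=s(w)$, and the plant is $\dot z=f(z,y,\mu)$, $\dot y=q(z,y,\mu)+u$. Let $P\subset\mathbb R^p$, $Z\subset\mathbb R^n$, $Y\subset\mathbb R$, $\Xi\subset\mathbb R^d$ and $W_0\subseteq W\subset\mathbb R^r$ be compact, where $W_0$ and $W$ are invariant in positive time for $\dot w=s(w)$. Norms are Euclidean, and $|x|_S$ denotes the distance of $x$ from $S$. Write $\mathbf z=(\mu,w,z)$, $\mathbf Z=P\times W\times Z$, $\mathbf f_0(\mathbf z)=(0,\,s(w),\,f(z,y_{\rm r}(w),\mu))$ and $\mathbf q_0(\mathbf z)=L_sy_{\rm r}(w)-q(z,y_{\rm r}(w),\mu)$, where $L_sy_{\rm r}$ is the derivative of $y_{\rm r}$ along $s$. Let $\mathcal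 A_0=\omega(\mathbf Z)$ be the $\omega$-limit set of $\mathbf Z$ under $\dot{\mathbf z}=\mathbf f_0(\mathbf z)$. Let $\tau=(\tau_1,\dots,\tau_d)$ with $\tau_1=\mathbf q_0$ and $\tau_{i+1}=\frac{\partial\tau_i}{\partial\mathbf z}\mathbf f_0$, and suppose that $\tau_1,\dots,\tau_d$ are well defined and $C^1$. Assume: * (stable steady state) the positive orbit of $\mathbf Z$ under $\dot{\mathbf z}=\mathbf f_0(\mathbf z)$ lies in a compact subset of $P\times W\times\mathbb R^n$; there is $d_1>0$ such that $\mathbf z\in P\times W\times\mathbb R^n$ and $|\mathbf z|_{\mathcal A_0}\le d_1$ imply $\mathbf z\in\mathbf Z$; and there are $m\ge1$, $a>0$, $0<d_2\le d_1$ such that $|\mathbf z(t)|_{\mathcal A_0}\le me^{-at}|\mathbf z(0)|_{\mathcal A_0}$ for all $t\ge0$, for all solutions with $\mathbf z(0)\in P\times W\times\mathbb R^n$ and $|\mathbf z(0)|_{\mathcal A_0}\le d_2$; * (immersion) there is a locally Lipschitz $\varphi:\mathbb R^d\to\mathbb R$ such that for every solution of $\dot{\mathbf z}=\mathbf f_0(\mathbf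 z)$ with $\mathbf z(0)\in\mathcal A_0$ the function $u(t)=\mathbf q_0(\mathbf z(t))$ satisfies $u^{(d)}(t)+\varphi(u(t),u^{(1)}(t),\dots,u^{(d-1)}(t))=0$ for all $t\ge0$. Let $\varphi_{\rm c}:\mathbb R^d\to\mathbb R$ be locally Lipschitz with compact support and equal to $\varphi$ on $\tau(\mathcal A_0)$. Let $c_0,\dots,c_{d-1}\in\mathbb R$ be such that $\lambda^d+c_{d-1}\lambda^{d-1}+\dots+c_0$ is Hurwitz. For $\kappa>0$ let $G=(\kappa c_{d-1},\kappa^2c_{d-2},\dots,\kappa^dc_0)^{\rm T}$, $\Gamma\xi=\xi_1$ and $\Phi_{\rm c}(\xi)=(\xi_2,\dots,\xi_d,-\varphi_{\rm c}(\xi))^{\rm T}$. **Closed loop.** Let $L_0=\max|x_i-x_i'|$ over all $x,x'\in W_0$ and $1\le i\le r$. Let $N\ge1$ be an integer such that every $\bar w\notin W$ satisfies $|\bar w|_{W_0}>\sqrt r\,L_0/(2N)$. Let $M:[0,\infty)\to\mathbb R$ be nondecreasing with $M(0)=1$ and $|w_1(t)-w_2(t)|\le M(t)|w_1(0)-w_2(0)|$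 for all $t\ge0$ and all solutions of $\dot w=s(w)$ that start in $W$. For a sampling interval $T>0$ and a gain $k>0$, the closed loop is $$\dot w_{\rm d}=s(w_{\rm d}),\quad \dot z=f(z,y,\mu),\quad \dot y=q(z,y,\mu)+\Gamma\xi-k(y-y_{\rm r}(w_{\rm d})),\quad \dot\xi=\Phi_{\rm c}(\xi)-Gk(y-y_{\rm r}(w_{\rm d})),$$ with constant $\mu$, continuous $z,y,\xi$, and the reset $w_{\rm d}(\ell T)=w_{\rm d}(\ell T^-)+w_{\rm q}(\ell)L(\ell)/N$ at the instants $\ell T$, $\ell\ge1$. Here $L(0)=L_0$, $L(\ell+1)=\sqrt r\,\frac{M(T)}{N}L(\ell)$, and, for a solution $w(\cdot)$ of the exosystem with $w(0)\in W_0$ and $\delta=w(\ell T)-w_{\rm d}(\ell T^-)$, the symbol $w_{\rm q}(\ell)$ has the components $\operatorname{sgn}(\delta_i)\left(\lceil N|\delta_i|/L(\ell)\rceil-\frac12\right)$ if $N$ is even, and $\operatorname{sgn}(\delta_i)\left\lceil N|\delta_i|/L(\ell)-\frac12\right\rceil$ if $N$ is odd (if $L(\ell)=0$, the reset leaves $w_{\rm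 d}$ unchanged). **Proposition.** There is $\kappa^*>0$ such that for every $\kappa\ge\kappa^*$ there are $T^*>0$, $k^*>0$ and compact sets $K,B\subset\mathbb R^p\times\mathbb R^r\times\mathbb R^n\times\mathbb R\times\mathbb R^d$ with $P\times W\times Z\times Y\times\Xi\subseteq K\subseteq P\times W\times Z\times\mathbb R\times\mathbb R^d$ such that the following holds for every $T>T^*$, every $k\ge k^*$, and all $N$ and $M$ as above with $N>\sqrt r\,M(T)$. For all $w(0)\in W_0$ and all initial conditions $(\mu,w_{\rm d}(0),z(0),y(0),\xi(0))\in P\times W\times Z\times Y\times\Xi$ the closed loop has a trajectory on $[0,\infty)$, and every trajectory with such initial conditions (on any interval of existence $[0,b)$, $b\le\infty$) is bounded in positive time: $(\mu,w_{\rm d}(t),z(t),y(t),\xi(t))\in B$ for all $t$. Moreover, at every sampling instant the state returns to the fixed compact set $K$: $(\mu,w_{\rm d}(\ell T),z(\ell T),y(\ell T),\xi(\ell T))\in K$ for all $\ell\ge0$, and $(\mu,w_{\rm d}(\ell T^-),z(\ell T),y(\ell T),\xi(\ell T))\in K$ for all $\ell\ge1$. -/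

import Mathlib

open Set Filter Topology

noncomputable section

namespace RemoteTracking

/-- `ℝᵐ` with the Euclidean norm. -/
abbrev Vec (m : ℕ) : Type := EuclideanSpace ℝ (Fin m)

/-- The state `(μ, w, z)` of the parameters, the exosystem and the zero dynamics. All conditions
below that use the distance on this product are insensitive to the choice of an equivalent norm. -/
abbrev ZState (p r n : ℕ) : Type := Vec p × Vec r × Vec n

/-- The state `(μ, w_d, z, y, ξ)` of the closed loop. -/
abbrev LoopState (p r n d : ℕ) : Type := Vec p × Vec r × Vec n × ℝ × Vec d

/-! ### Autonomous differential equations -/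

/-- `x` is a solution of `x' = F(x)` on `[0, ∞)`. -/
def IsSolution {E : Type*} [NormedAddCommGroup E] [NormedSpace ℝ E] (F : E → E) (x : ℝ → E) :
    Prop :=
  ∀ t : ℝ, 0 ≤ t → HasDerivWithinAt x (F (x t)) (Ici 0) t

/-- `S` is invariant in positive time for `x' = F(x)`. -/
def IsInvariantSet {E : Type*} [NormedAddCommGroup E] [NormedSpace ℝ E] (F : E → E) (S : Set E) :
    Prop :=
  ∀ x₀ ∈ S, ∃ x : ℝ → E, IsSolution F x ∧ x 0 = x₀ ∧ ∀ t : ℝ, 0 ≤ t → x t ∈ S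

/-- The `ω`-limit set `ω(X)` of a set `X` of initial conditions of `x' = F(x)`. -/
def omegaLimitSet {E : Type*} [NormedAddCommGroup E] [NormedSpace ℝ E] (F : E → E) (X : Set E) :
    Set E :=
  ⋂ t₀ : ℝ, ⋂ _ : 0 ≤ t₀,
    closure {v : E | ∃ x : ℝ → E, IsSolution F x ∧ x 0 ∈ X ∧ ∃ t : ℝ, t₀ ≤ t ∧ x t = v}

/-! ### The plant in steady state -/

section Plant

variable {p r n : ℕ}

/-- The vector field `𝐟₀` of `μ' = 0`, `w' = s(w)`, `z' = f(z, y_r(w), μ)`. -/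
def f0 (s : Vec r → Vec r) (f : Vec n × ℝ × Vec p → Vec n) (yr : Vec r → ℝ) :
    ZState p r n → ZState p r n :=
  fun v => (0, s v.2.1, f (v.2.2, yr v.2.1, v.1))

/-- The steady state input `𝐪₀(μ, w, z) = L_s y_r(w) - q(z, y_r(w), μ)`. -/
def q0 (s : Vec r → Vec r) (q : Vec n × ℝ × Vec p → ℝ) (yr : Vec r → ℝ) : ZState p r n → ℝ :=
  fun v => fderiv ℝ yr v.2.1 (s v.2.1) - q (v.2.2, yr v.2.1, v.1)

/-- The iterated derivatives of an output `h` along the vector field `F`: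
`lieIter F h i` is the function `τ_{i+1}`. -/
def lieIter (F : ZState p r n → ZState p r n) (h : ZState p r n → ℝ) : ℕ → ZState p r n → ℝ
  | 0 => h
  | i + 1 => fun v => fderiv ℝ (lieIter F h i) v (F v)

/-- The map `τ = col(τ₁, …, τ_d)`. -/
def tau (F : ZState p r n → ZState p r n) (h : ZState p r n → ℝ) (d : ℕ) (v : ZState p r n) :
    Vec d :=
  WithLp.toLp 2 fun i : Fin d => lieIter F h i v

/-- The positive orbit of `𝐙 = P × W × Z` under `v' = F(v)` lies in a compact subset of
`P × W × ℝⁿ`; relative to `P × W × ℝⁿ` the set `𝐙` is a neighbourhood, of some radius `d₁`, of the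
set `ω(𝐙)`, and `ω(𝐙)` is locally exponentially stable. -/
def HasExpStableSteadyState (F : ZState p r n → ZState p r n) (P : Set (Vec p)) (W : Set (Vec r))
    (Z : Set (Vec n)) : Prop :=
  (∃ C : Set (ZState p r n), IsCompact C ∧ C ⊆ P ×ˢ W ×ˢ univ ∧
    ∀ v₀ ∈ P ×ˢ W ×ˢ Z, ∃ x : ℝ → ZState p r n,
      IsSolution F x ∧ x 0 = v₀ ∧ ∀ t : ℝ, 0 ≤ t → x t ∈ C) ∧
  ∃ d₁ : ℝ, 0 < d₁ ∧
    (∀ v ∈ P ×ˢ W ×ˢ (univ : Set (Vec n)),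
      Metric.infDist v (omegaLimitSet F (P ×ˢ W ×ˢ Z)) ≤ d₁ → v ∈ P ×ˢ W ×ˢ Z) ∧
    ∃ m a d₂ : ℝ, 1 ≤ m ∧ 0 < a ∧ 0 < d₂ ∧ d₂ ≤ d₁ ∧
      ∀ x : ℝ → ZState p r n, IsSolution F x → x 0 ∈ P ×ˢ W ×ˢ (univ : Set (Vec n)) →
        Metric.infDist (x 0) (omegaLimitSet F (P ×ˢ W ×ˢ Z)) ≤ d₂ → ∀ t : ℝ, 0 ≤ t →
          Metric.infDist (x t) (omegaLimitSet F (P ×ˢ W ×ˢ Z)) ≤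
            m * Real.exp (-a * t) * Metric.infDist (x 0) (omegaLimitSet F (P ×ˢ W ×ˢ Z))

/-- Along every solution in positive time of `v' = F(v)` that starts in `A`, the output
`u = h(v(t))` satisfies `u^{(d)} + φ(u, u^{(1)}, …, u^{(d-1)}) = 0`. -/
def HasImmersion (F : ZState p r n → ZState p r n) (h : ZState p r n → ℝ) (A : Set (ZState p r n))
    (d : ℕ) (φ : Vec d → ℝ) : Prop :=
  ∀ x : ℝ → ZState p r n, IsSolution F x → x 0 ∈ A → ∀ t : ℝ, 0 ≤ t →
    iteratedDerivWithin d (fun t' => h (x t')) (Ici 0) t +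
      φ (WithLp.toLp 2 fun i : Fin d =>
        iteratedDerivWithin i (fun t' => h (x t')) (Ici 0) t) = 0

end Plant

/-! ### The internal model -/

/-- `λ^d + c_{d-1} λ^{d-1} + ⋯ + c₀` is Hurwitz. -/
def IsHurwitz {d : ℕ} (c : Fin d → ℝ) : Prop :=
  ∀ x : ℂ, x ^ d + ∑ i : Fin d, (c i : ℂ) * x ^ (i : ℕ) = 0 → x.re < 0

/-- `Φ_c(ξ) = col(ξ₂, …, ξ_d, -φ_c(ξ))`. -/
def PhiC {d : ℕ} (φc : Vec d → ℝ) (ξ : Vec d) : Vec d :=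
  WithLp.toLp 2 fun i : Fin d => if h : (i : ℕ) + 1 < d then ξ ⟨i + 1, h⟩ else -φc ξ

/-- `G = col(κ c_{d-1}, κ² c_{d-2}, …, κ^d c₀)`. -/
def gainG {d : ℕ} (κ : ℝ) (c : Fin d → ℝ) : Vec d :=
  WithLp.toLp 2 fun i : Fin d => κ ^ ((i : ℕ) + 1) * c i.rev

/-! ### The encoder-decoder pair -/

section Coder

variable {r : ℕ}

/-- `L₀ = max |x_i - y_i|` over all coordinates `i` and all `x, y ∈ W₀`. -/
def L0 (W₀ : Set (Vec r)) : ℝ :=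
  sSup {a : ℝ | ∃ i : Fin r, ∃ x ∈ W₀, ∃ y ∈ W₀, a = |x i - y i|}

/-- The size `L(ℓ)` of the quantization region, where `M` is the number `M(T)`. -/
def Lseq (W₀ : Set (Vec r)) (N : ℕ) (M : ℝ) : ℕ → ℝ
  | 0 => L0 W₀
  | ℓ + 1 => Real.sqrt r * (M / N) * Lseq W₀ N M ℓ

/-- The transmitted symbol `w_q`, when the exosystem is at `w`, the decoder is at `wd` and the
size of the quantization region is `L`. -/
def quant (N : ℕ) (L : ℝ) (w wd : Vec r) : Vec r :=
  WithLp.toLp 2 fun i : Fin r =>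
    Real.sign (w i - wd i) *
      (if Even N then (⌈(N : ℝ) * |w i - wd i| / L⌉ : ℝ) - 1 / 2
        else (⌈(N : ℝ) * |w i - wd i| / L - 1 / 2⌉ : ℝ))

/-- Every point outside of `W` has distance more than `√r L₀ / (2 N)` from `W₀`. -/
def IsMargin (W₀ W : Set (Vec r)) (N : ℕ) : Prop :=
  ∀ v : Vec r, v ∉ W → Real.sqrt r * (L0 W₀ / (2 * N)) < Metric.infDist v W₀

/-- `M` is nondecreasing on `[0, ∞)`, `M(0) = 1`, and `M` bounds the growth of the distance between
any two solutions of `w' = s(w)` that start in `W`. -/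
def IsGrowthBound (s : Vec r → Vec r) (W : Set (Vec r)) (M : ℝ → ℝ) : Prop :=
  MonotoneOn M (Ici 0) ∧ M 0 = 1 ∧
    ∀ w₁ w₂ : ℝ → Vec r, IsSolution s w₁ → IsSolution s w₂ → w₁ 0 ∈ W → w₂ 0 ∈ W →
      ∀ t : ℝ, 0 ≤ t → ‖w₁ t - w₂ t‖ ≤ M t * ‖w₁ 0 - w₂ 0‖

end Coder

/-! ### The closed loop -/

/-- The time interval `[0, b)`, with `0 < b ≤ ∞`. -/
def timeDomain (b : EReal) : Set ℝ := {t : ℝ | 0 ≤ t ∧ (t : EReal) < b}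

/-- `(wd, z, y, ξ)` is a trajectory on `[0, b)` of the closed loop with parameter `μ`, driven by the
solution `w` of the exosystem: on every sampling period `[ℓT, (ℓ+1)T)` the differential equations
hold (at `ℓT` with right derivatives), `z`, `y`, `ξ` are continuous, and at every sampling instant
`ℓT`, `ℓ ≥ 1`, the decoder is reset from its left limit `wdm ℓ = w_d(ℓT⁻)`. -/
structure IsTrajectory {p r n d : ℕ} [NeZero d]
    (s : Vec r → Vec r) (f : Vec n × ℝ × Vec p → Vec n) (q : Vec n × ℝ × Vec p → ℝ)
    (yr : Vec r → ℝ) (φc : Vec d → ℝ) (G : Vec d) (k T : ℝ) (N : ℕ) (L : ℕ → ℝ) (b : EReal)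
    (μ : Vec p) (w wd : ℝ → Vec r) (wdm : ℕ → Vec r) (z : ℝ → Vec n) (y : ℝ → ℝ) (ξ : ℝ → Vec d) :
    Prop where
  exo : IsSolution s w
  wd_flow : ∀ ℓ : ℕ, ∀ t ∈ timeDomain b ∩ Ico (ℓ * T) ((ℓ + 1) * T),
    HasDerivWithinAt wd (s (wd t)) (Ico (ℓ * T) ((ℓ + 1) * T)) t
  z_flow : ∀ ℓ : ℕ, ∀ t ∈ timeDomain b ∩ Ico (ℓ * T) ((ℓ + 1) * T),
    HasDerivWithinAt z (f (z t, y t, μ)) (Ico (ℓ * T) ((ℓ + 1) * T)) t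
  y_flow : ∀ ℓ : ℕ, ∀ t ∈ timeDomain b ∩ Ico (ℓ * T) ((ℓ + 1) * T),
    HasDerivWithinAt y (q (z t, y t, μ) + ξ t 0 - k * (y t - yr (wd t)))
      (Ico (ℓ * T) ((ℓ + 1) * T)) t
  ξ_flow : ∀ ℓ : ℕ, ∀ t ∈ timeDomain b ∩ Ico (ℓ * T) ((ℓ + 1) * T),
    HasDerivWithinAt ξ (PhiC φc (ξ t) - (k * (y t - yr (wd t))) • G)
      (Ico (ℓ * T) ((ℓ + 1) * T)) t
  z_cont : ContinuousOn z (timeDomain b)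
  y_cont : ContinuousOn y (timeDomain b)
  ξ_cont : ContinuousOn ξ (timeDomain b)
  wd_left : ∀ ℓ : ℕ, 1 ≤ ℓ → (ℓ * T : ℝ) ∈ timeDomain b →
    Tendsto wd (𝓝[<] (ℓ * T : ℝ)) (𝓝 (wdm ℓ))
  wd_reset : ∀ ℓ : ℕ, 1 ≤ ℓ → (ℓ * T : ℝ) ∈ timeDomain b →
    wd (ℓ * T) = wdm ℓ + (L ℓ / N) • quant N (L ℓ) (w (ℓ * T)) (wdm ℓ)

end RemoteTracking

end

/-!
The assertion concerns boundedness and the return to a fixed set `K` at the sampling instants; the set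

  `K = P × W × Z × {|y| ≤ Y_m} × {|ξ| ≤ R_ξ}`

is a product, so that it is not left at the resets, which change `w_d` only. It remains to see that the
decoder state stays in `W`, and that a sampling period which starts in `K` is back in `K` after a time
that does not depend on the gain `k`.

*The decoder.* The quantizer does not saturate, so a reset always leaves an error of at most
`L(ℓ) / (2N) ≤ L₀ / (2N)` in each coordinate (`abs_sub_reset_le`), and the margin of `W₀` in `W` keeps
`w_d` in `W` (`reset_mem`).

*One period.* Between resets the loop is autonomous. With `e = y - y_r(w_d)` and `χ = ξ - e G` one has
`e' = -k e + O(1)`, hence `e = O(e^{-kt/2}) + O(1/k)` (`abs_le_of_high_gain`), and `χ' = A χ + O(1)`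
independently of `k`, where `A` is the companion matrix of a Hurwitz polynomial and the input is bounded
because `φ_c` is (`exists_isModelBound`). Stability of `A` is used in the form of
`exists_decay_of_eigenvalue_re_neg`, which removes the roots of the minimal polynomial one at a time.
The state `z` is compared with the solution `ζ` of the zero dynamics that starts at the same point.
As the transient of `e` has an integral of order `1/k`, Gronwall's lemma makes `z - ζ` of order `1/k` on
any fixed horizon (`norm_le_of_fast_transient`). By compactness `ω(P × W × Z)` attracts
`P × W × Z` uniformly (`exists_attraction_time`), and it has a neighbourhood in `P × W × Z`. Thus `z` is in
`Z` from some time `T₁` up to `2 T₁`, and restarting the comparison it stays in `Z` ever after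
(`zero_dynamics_bound`). These estimates hold as long as `z` and `e` are in a certain bounded region, which
they do not leave, by a continuity argument (`closed_loop_bound`).

The a priori bounds also give existence: the field cut off outside of a large ball has a solution on the
whole period, which solves the original equation.
-/

namespace RemoteTracking

/-! ### Autonomous differential equations on compact intervals -/


section ODE

variable {E : Type*} [NormedAddCommGroup E] [NormedSpace ℝ E]

/-- `x` is a solution of `x' = F(x)` on the compact interval `[0, b]`, with one-sided derivatives at
the endpoints. -/
def IsSolutionOn (F : E → E) (x : ℝ → E) (b : ℝ) : Prop :=
  ∀ t ∈ Icc 0 b, HasDerivWithinAt x (F (x t)) (Icc 0 b) t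

lemma hasDerivWithinAt_comp_add {x : ℝ → E} {x' : E} {a t : ℝ} {S S' : Set ℝ}
    (h : HasDerivWithinAt x x' S (t + a)) (hS : MapsTo (fun τ => τ + a) S' S) :
    HasDerivWithinAt (fun τ => x (τ + a)) x' S' t := by
  simpa [Function.comp_def] using
    h.scomp t ((hasDerivAt_id t).add_const a).hasDerivWithinAt hS

lemma hasDerivWithinAt_Icc_shift {x : ℝ → E} {x' : E} {a b t : ℝ} {S : Set ℝ}
    (h : HasDerivWithinAt x x' S (t + a)) (hS : Icc a (b + a) ⊆ S) :
    HasDerivWithinAt (fun τ => x (τ + a)) x' (Icc 0 b) t :=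
  hasDerivWithinAt_comp_add h fun τ hτ => hS ⟨by linarith [hτ.1], by linarith [hτ.2]⟩

lemma IsSolution.isSolutionOn {F : E → E} {x : ℝ → E} (h : IsSolution F x) (b : ℝ) :
    IsSolutionOn F x b :=
  fun t ht => (h t ht.1).mono Icc_subset_Ici_self

lemma IsSolutionOn.continuousOn {F : E → E} {x : ℝ → E} {b : ℝ} (h : IsSolutionOn F x b) :
    ContinuousOn x (Icc 0 b) :=
  fun t ht => (h t ht).continuousWithinAt

lemma IsSolutionOn.mono {F : E → E} {x : ℝ → E} {b c : ℝ} (h : IsSolutionOn F x b) (hc : c ≤ b) :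
    IsSolutionOn F x c :=
  fun t ht => (h t ⟨ht.1, ht.2.trans hc⟩).mono (Icc_subset_Icc_right hc)

lemma IsSolutionOn.shift {F : E → E} {x : ℝ → E} {b a : ℝ} (h : IsSolutionOn F x b) (ha : 0 ≤ a) :
    IsSolutionOn F (fun t => x (t + a)) (b - a) := fun t ht =>
  hasDerivWithinAt_Icc_shift (h (t + a) ⟨by linarith [ht.1], by linarith [ht.2]⟩)
    (by rw [sub_add_cancel]; exact Icc_subset_Icc_left ha)

lemma hasDerivWithinAt_Ici_of_Icc {x : ℝ → E} {x' : E} {b t : ℝ} (ht : t ∈ Ico 0 b)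
    (h : HasDerivWithinAt x x' (Icc 0 b) t) : HasDerivWithinAt x x' (Ici t) t :=
  h.mono_of_mem_nhdsWithin (mem_of_superset (Icc_mem_nhdsGE ht.2) (Icc_subset_Icc_left ht.1))

lemma exists_lipschitzOnWith_of_isCompact {X Y : Type*} [PseudoMetricSpace X] [PseudoMetricSpace Y]
    {F : X → Y} (hF : LocallyLipschitz F) {S : Set X} (hS : IsCompact S) :
    ∃ K, LipschitzOnWith K F S :=
  (hF.locallyLipschitzOn (s := S)).exists_lipschitzOnWith_of_compact hS

lemma IsSolutionOn.eqOn [ProperSpace E] {F : E → E} (hF : LocallyLipschitz F) {x y : ℝ → E} {b : ℝ}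
    (hx : IsSolutionOn F x b) (hy : IsSolutionOn F y b) (h0 : x 0 = y 0) : EqOn x y (Icc 0 b) := by
  have hS : IsCompact (x '' Icc 0 b ∪ y '' Icc 0 b) :=
    (isCompact_Icc.image_of_continuousOn hx.continuousOn).union
      (isCompact_Icc.image_of_continuousOn hy.continuousOn)
  obtain ⟨K, hK⟩ := exists_lipschitzOnWith_of_isCompact hF hS
  exact ODE_solution_unique_of_mem_Icc_right (v := fun _ => F)
    (s := fun _ => x '' Icc 0 b ∪ y '' Icc 0 b) (fun _ _ => hK) hx.continuousOn
    (fun t ht => hasDerivWithinAt_Ici_of_Icc ht (hx t (Ico_subset_Icc_self ht)))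
    (fun t ht => Or.inl (mem_image_of_mem x (Ico_subset_Icc_self ht))) hy.continuousOn
    (fun t ht => hasDerivWithinAt_Ici_of_Icc ht (hy t (Ico_subset_Icc_self ht)))
    (fun t ht => Or.inr (mem_image_of_mem y (Ico_subset_Icc_self ht))) h0

lemma IsInvariantSet.mem_of_isSolutionOn [ProperSpace E] {F : E → E} (hF : LocallyLipschitz F)
    {S : Set E} (hS : IsInvariantSet F S) {x : ℝ → E} {b : ℝ} (hx : IsSolutionOn F x b)
    (h0 : x 0 ∈ S) {t : ℝ} (ht : t ∈ Icc 0 b) : x t ∈ S := by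
  obtain ⟨y, hy, hy0, hyS⟩ := hS _ h0
  rw [hx.eqOn hF (hy.isSolutionOn b) hy0.symm ht]
  exact hyS t ht.1

/-- A continuous curve that starts in the open set `U`, and is in the closed set `A` for as long as
it has not left `U`, where `A ⊆ U`, never leaves `A`. -/
lemma forall_mem_of_bootstrap {X : Type*} [TopologicalSpace X] {x : ℝ → X} {b : ℝ}
    (hx : ContinuousOn x (Icc 0 b)) {A U : Set X} (hA : IsClosed A) (hU : IsOpen U) (hAU : A ⊆ U)
    (h0 : x 0 ∈ U)
    (h : ∀ t ∈ Icc 0 b, (∀ τ ∈ Icc 0 t, x τ ∈ U) → x t ∈ A) : ∀ t ∈ Icc 0 b, x t ∈ A := by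
  suffices hall : ∀ t ∈ Icc 0 b, x t ∈ U from
    fun t ht => h t ht fun τ hτ => hall τ ⟨hτ.1, hτ.2.trans ht.2⟩
  by_contra! hne
  obtain ⟨t₁, ht₁, hxt₁⟩ := hne
  have hcl : IsClosed (Icc 0 b ∩ x ⁻¹' Uᶜ) :=
    hx.preimage_isClosed_of_isClosed isClosed_Icc hU.isClosed_compl
  have hcpt : IsCompact (Icc 0 b ∩ x ⁻¹' Uᶜ) := isCompact_Icc.of_isClosed_subset hcl inter_subset_left
  -- the first instant `σ` at which the curve is outside of `U`
  obtain ⟨σ, ⟨hσ, hxσ⟩, hmin⟩ := hcpt.exists_isLeast ⟨t₁, ht₁, hxt₁⟩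
  have hbefore : ∀ τ ∈ Ico 0 σ, x τ ∈ U := fun τ hτ => by
    by_contra hc
    exact absurd (hmin ⟨⟨hτ.1, hτ.2.le.trans hσ.2⟩, hc⟩) (not_le.mpr hτ.2)
  have hpos : 0 < σ := lt_of_le_of_ne hσ.1 fun he => hxσ (by rw [← he]; exact h0)
  have hAσ : ∀ τ ∈ Ico 0 σ, x τ ∈ A := fun τ hτ =>
    h τ ⟨hτ.1, hτ.2.le.trans hσ.2⟩ fun τ' hτ' => hbefore τ' ⟨hτ'.1, hτ'.2.trans_lt hτ.2⟩
  have hcw : ContinuousWithinAt x (Ico 0 σ) σ :=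
    (hx σ hσ).mono fun τ hτ => ⟨hτ.1, hτ.2.le.trans hσ.2⟩
  have hmem : σ ∈ closure (Ico 0 σ) := by
    rw [closure_Ico hpos.ne]; exact right_mem_Icc.mpr hpos.le
  exact hxσ (hAU (hA.closure_subset (hcw.mem_closure hmem hAσ)))

/-- **Global existence from an a priori bound**: if all solutions that start at `x₀` stay in the ball
of radius `ρ` for as long as they exist, there is a solution on `[0, b]`. -/
lemma exists_isSolutionOn_of_bound [FiniteDimensional ℝ E] {F : E → E} (hF : LocallyLipschitz F)
    {b ρ : ℝ} (hb : 0 ≤ b) {x₀ : E}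
    (hbound : ∀ c ∈ Icc 0 b, ∀ x : ℝ → E, IsSolutionOn F x c → x 0 = x₀ → ‖x c‖ ≤ ρ) :
    ∃ x : ℝ → E, IsSolutionOn F x b ∧ x 0 = x₀ := by
  have hρ : ‖x₀‖ ≤ ρ := by
    have hsol0 : IsSolutionOn F (fun t => x₀ + t • F x₀) 0 := by
      rintro t ⟨h1, h2⟩
      obtain rfl : t = 0 := le_antisymm h2 h1
      simpa using (((hasDerivAt_id (0 : ℝ)).smul_const (F x₀)).const_add x₀).hasDerivWithinAt
    simpa using hbound 0 ⟨le_rfl, hb⟩ _ hsol0 (by simp)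
  have := FiniteDimensional.proper ℝ E
  -- cut the vector field off outside of the ball of radius `ρ + 1`
  let g : E → ℝ := fun v => max 0 (min 1 (ρ + 2 - ‖v‖))
  have hg : LocallyLipschitz g :=
    (((LipschitzWith.const (ρ + 2)).sub lipschitzWith_one_norm).locallyLipschitz.const_min 1).const_max 0
  have hg1 : ∀ v, ‖v‖ ≤ ρ + 1 → g v = 1 := fun v hv => by
    simp only [g]
    rw [min_eq_left (by linarith), max_eq_right zero_le_one]
  have hg0 : ∀ v, v ∉ Metric.closedBall (0 : E) (ρ + 2) → g v = 0 := fun v hv => by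
    rw [mem_closedBall_zero_iff, not_le] at hv
    simp only [g]
    rw [min_eq_right (by linarith), max_eq_left (by linarith)]
  let F' : E → E := fun v => g v • F v
  have hF' : LocallyLipschitz F' :=
    (contDiff_fst.smul contDiff_snd : ContDiff ℝ 1 fun v : ℝ × E => v.1 • v.2).locallyLipschitz.comp
      (hg.prodMk hF)
  obtain ⟨L, hL⟩ : ∃ L, ∀ v, ‖F' v‖ ≤ L :=
    (HasCompactSupport.intro (isCompact_closedBall (0 : E) (ρ + 2))
      (fun v hv => by simp only [F', hg0 v hv, zero_smul])).exists_bound_of_continuous hF'.continuous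
  have hL0 : 0 ≤ L := (norm_nonneg _).trans (hL 0)
  obtain ⟨K, hK⟩ := exists_lipschitzOnWith_of_isCompact hF' (isCompact_closedBall x₀ (L * b))
  have hPL : IsPicardLindelof (fun _ => F') (tmin := 0) (tmax := b) ⟨0, le_rfl, hb⟩ x₀
      ⟨L * b, by positivity⟩ 0 ⟨L, hL0⟩ K :=
    { lipschitzOnWith := fun _ _ => hK
      continuousOn := fun _ _ => continuousOn_const
      norm_le := fun _ _ v _ => hL v
      mul_max_le := by
        rw [sub_zero, sub_self, max_eq_left hb, NNReal.coe_zero, sub_zero]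
        exact le_rfl }
  obtain ⟨x, hx0, hx⟩ := hPL.exists_eq_forall_mem_Icc_hasDerivWithinAt₀
  have hxsol : IsSolutionOn F' x b := hx
  have hx0 : x 0 = x₀ := hx0
  have hsol : ∀ c ∈ Icc 0 b, (∀ τ ∈ Icc 0 c, x τ ∈ Metric.ball (0 : E) (ρ + 1)) →
      IsSolutionOn F x c := fun c hc hball t ht => by
    have h1 := hxsol.mono hc.2 t ht
    have h2 : F' (x t) = F (x t) := by
      simp only [F']
      rw [hg1 _ (mem_ball_zero_iff.mp (hball t ht)).le, one_smul]
    rwa [h2] at h1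
  have hstay : ∀ t ∈ Icc 0 b, x t ∈ Metric.closedBall (0 : E) ρ :=
    forall_mem_of_bootstrap hxsol.continuousOn Metric.isClosed_closedBall Metric.isOpen_ball
      (Metric.closedBall_subset_ball (by linarith))
      (by rw [hx0, mem_ball_zero_iff]; linarith)
      fun c hc hball => mem_closedBall_zero_iff.mpr (hbound c hc x (hsol c hc hball) hx0)
  exact ⟨x, hsol b ⟨hb, le_rfl⟩ fun τ hτ =>
    Metric.closedBall_subset_ball (by linarith) (hstay τ hτ), hx0⟩

end ODE

/-! ### Input-to-state stability of Hurwitz linear systems -/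


section Decay

variable {E : Type*} [NormedAddCommGroup E] [NormedSpace ℝ E] [NormedSpace ℂ E]
  [IsScalarTower ℝ ℂ E]

/-- Variation of constants for a scalar mode: if `v' = l v + O(A e^{-αt} + B)`, where
`Re l ≤ -2α`, then `v` is of the same order, up to its initial value. -/
lemma norm_le_of_norm_deriv_sub_smul_le {v v' : ℝ → E} {b α A B : ℝ} {l : ℂ} (hα : 0 < α)
    (hl : l.re ≤ -(2 * α)) (hA : 0 ≤ A) (hB : 0 ≤ B)
    (hv : ∀ t ∈ Icc 0 b, HasDerivWithinAt v (v' t) (Icc 0 b) t)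
    (hbd : ∀ t ∈ Icc 0 b, ‖v' t - l • v t‖ ≤ A * Real.exp (-α * t) + B) :
    ∀ t ∈ Icc 0 b, ‖v t‖ ≤ Real.exp (-α * t) * (‖v 0‖ + A / α) + B / α := by
  intro t ht
  set β : ℝ := -l.re with hβ
  have hβα : 2 * α ≤ β := by linarith
  have hexp : ∀ τ : ℝ, HasDerivAt (fun τ : ℝ => Complex.exp (-l * τ)) (-l * Complex.exp (-l * τ)) τ := by
    intro τ
    have h1 : HasDerivAt (fun τ : ℝ => -l * (τ : ℂ)) (-l) τ := by
      simpa using ((Complex.ofRealCLM.hasDerivAt (x := τ)).const_mul (-l))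
    simpa [mul_comm] using h1.cexp
  have hnorm : ∀ τ : ℝ, ‖Complex.exp (-l * τ)‖ = Real.exp (β * τ) := by
    intro τ
    rw [Complex.norm_exp]
    simp [hβ]
  have hg : ∀ τ ∈ Icc 0 b, HasDerivWithinAt (fun τ : ℝ => Complex.exp (-l * τ) • v τ)
      (Complex.exp (-l * τ) • (v' τ - l • v τ)) (Icc 0 b) τ := by
    intro τ hτ
    have h : HasDerivWithinAt (fun τ : ℝ => Complex.exp (-l * τ) • v τ)
        (Complex.exp (-l * τ) • v' τ + (-l * Complex.exp (-l * τ)) • v τ) (Icc 0 b) τ :=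
      (hexp τ).hasDerivWithinAt.smul (hv τ hτ)
    convert h using 1
    rw [smul_sub, smul_smul, sub_eq_add_neg, ← neg_smul, mul_comm (-l) (Complex.exp _), mul_neg]
  have key := image_norm_le_of_norm_deriv_right_le_deriv_boundary
    (f := fun τ : ℝ => Complex.exp (-l * τ) • v τ)
    (B := fun τ => ‖v 0‖ + A / α * Real.exp ((β - α) * τ) + B / α * Real.exp (β * τ))
    (B' := fun τ => A / α * (Real.exp ((β - α) * τ) * (β - α)) + B / α * (Real.exp (β * τ) * β))
    (fun τ hτ => (hg τ hτ).continuousWithinAt)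
    (fun τ hτ => hasDerivWithinAt_Ici_of_Icc hτ (hg τ (Ico_subset_Icc_self hτ)))
    (by
      have h : 0 ≤ A / α + B / α := by positivity
      simp only [Complex.ofReal_zero, mul_zero, Complex.exp_zero, one_smul, Real.exp_zero, mul_one]
      linarith)
    (fun τ => by
      have h1 : HasDerivAt (fun τ => Real.exp ((β - α) * τ)) (Real.exp ((β - α) * τ) * (β - α)) τ := by
        simpa using ((hasDerivAt_id τ).const_mul (β - α)).exp
      have h2 : HasDerivAt (fun τ => Real.exp (β * τ)) (Real.exp (β * τ) * β) τ := by
        simpa using ((hasDerivAt_id τ).const_mul β).exp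
      exact ((h1.const_mul (A / α)).const_add ‖v 0‖).add (h2.const_mul (B / α)))
    (fun τ hτ => by
      rw [norm_smul, hnorm]
      have h1 := mul_le_mul_of_nonneg_left (hbd τ (Ico_subset_Icc_self hτ)) (Real.exp_pos (β * τ)).le
      have h2 : Real.exp (β * τ) * Real.exp (-α * τ) = Real.exp ((β - α) * τ) := by
        rw [← Real.exp_add]; ring_nf
      have h3 : A * Real.exp ((β - α) * τ) ≤ A / α * (Real.exp ((β - α) * τ) * (β - α)) := by
        have : A / α * α ≤ A / α * (β - α) :=
          mul_le_mul_of_nonneg_left (by linarith) (by positivity)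
        rw [div_mul_cancel₀ _ hα.ne'] at this
        nlinarith [Real.exp_pos ((β - α) * τ)]
      have h4 : B * Real.exp (β * τ) ≤ B / α * (Real.exp (β * τ) * β) := by
        have : B / α * α ≤ B / α * β :=
          mul_le_mul_of_nonneg_left (by linarith) (by positivity)
        rw [div_mul_cancel₀ _ hα.ne'] at this
        nlinarith [Real.exp_pos (β * τ)]
      have h5 : Real.exp (β * τ) * (A * Real.exp (-α * τ) + B)
          = A * Real.exp ((β - α) * τ) + B * Real.exp (β * τ) := by
        rw [← h2]; ring
      linarith) ht
  simp only [norm_smul, hnorm] at key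
  have h6 : ‖v t‖ = Real.exp (-β * t) * (Real.exp (β * t) * ‖v t‖) := by
    rw [← mul_assoc, ← Real.exp_add]; simp
  rw [h6]
  refine (mul_le_mul_of_nonneg_left key (Real.exp_pos _).le).trans ?_
  have h7 : Real.exp (-β * t) * Real.exp ((β - α) * t) = Real.exp (-α * t) := by
    rw [← Real.exp_add]; ring_nf
  have h8 : Real.exp (-β * t) * Real.exp (β * t) = 1 := by
    rw [← Real.exp_add]; simp
  have h9 : Real.exp (-β * t) ≤ Real.exp (-α * t) :=
    Real.exp_le_exp.mpr (by nlinarith [ht.1])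
  have h10 : Real.exp (-β * t) *
      (‖v 0‖ + A / α * Real.exp ((β - α) * t) + B / α * Real.exp (β * t)) =
      Real.exp (-β * t) * ‖v 0‖ + A / α * Real.exp (-α * t) + B / α := by
    rw [← h7]; linear_combination (B / α) * h8
  rw [h10]
  nlinarith [mul_le_mul_of_nonneg_right h9 (norm_nonneg (v 0))]

/-- Input-to-state stability of the part `Q x` of the state, when `Q` is annihilated by the product of the
factors `A - l` over the stable numbers `l` in `s`. The factors are removed one at a time:
`Q x` solves `(Q x)' = l (Q x) + (A - l) Q x + Q u`, and `(A - l) Q` is annihilated by one factor less. -/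
lemma exists_decay_of_prod_eq_zero [FiniteDimensional ℂ E] (A : Module.End ℂ E) {α : ℝ}
    (hα : 0 < α) (s : Multiset ℂ) (hs : ∀ l ∈ s, l.re ≤ -(2 * α)) (Q : Module.End ℂ E)
    (hQA : Q * A = A * Q)
    (hQ : Polynomial.aeval A (s.map fun l => Polynomial.X - Polynomial.C l).prod * Q = 0) :
    ∃ C, 0 ≤ C ∧ ∀ (b U : ℝ) (x u : ℝ → E), 0 ≤ U →
      (∀ t ∈ Icc 0 b, HasDerivWithinAt x (A (x t) + u t) (Icc 0 b) t) →
      (∀ t ∈ Icc 0 b, ‖u t‖ ≤ U) →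
      ∀ t ∈ Icc 0 b, ‖Q (x t)‖ ≤ C * (Real.exp (-α * t) * ‖x 0‖ + U) := by
  induction s using Multiset.induction_on generalizing Q with
  | empty =>
    refine ⟨0, le_rfl, fun b U x u _ _ _ t _ => ?_⟩
    have : Q = 0 := by simpa using hQ
    simp [this]
  | cons l s ih =>
    obtain ⟨C, hC0, hC⟩ := ih (fun l' hl' => hs l' (Multiset.mem_cons_of_mem hl'))
      ((A - algebraMap ℂ _ l) * Q)
      (by
        rw [mul_assoc, hQA, ← mul_assoc, ← mul_assoc, sub_mul, mul_sub,
          Algebra.commutes l A])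
      (by
        rw [← hQ, Multiset.map_cons, Multiset.prod_cons, mul_comm, map_mul, mul_assoc, map_sub,
          Polynomial.aeval_X, Polynomial.aeval_C])
    let Qc : E →L[ℂ] E := LinearMap.toContinuousLinearMap Q
    have hQc : ∀ v, Qc v = Q v := fun v => rfl
    refine ⟨‖Qc‖ + C / α + (C + ‖Qc‖) / α, by positivity, ?_⟩
    intro b U x u hU hx hu t ht
    have hder : ∀ τ ∈ Icc 0 b, HasDerivWithinAt (fun τ => Qc (x τ)) (Qc (A (x τ) + u τ))
        (Icc 0 b) τ := fun τ hτ =>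
      (Qc.restrictScalars ℝ).hasFDerivAt.comp_hasDerivWithinAt τ (hx τ hτ)
    have hmode : ∀ τ, Qc (A (x τ) + u τ) - l • Qc (x τ)
        = ((A - algebraMap ℂ _ l) * Q) (x τ) + Qc (u τ) := by
      intro τ
      have h1 : Q (A (x τ)) = A (Q (x τ)) := by
        simpa using congrArg (fun R : Module.End ℂ E => R (x τ)) hQA
      simp only [hQc, map_add, h1, Module.End.mul_apply, LinearMap.sub_apply,
        Module.algebraMap_end_apply]
      abel
    have h2 := norm_le_of_norm_deriv_sub_smul_le hα (hs l (Multiset.mem_cons_self l s))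
      (A := C * ‖x 0‖) (B := (C + ‖Qc‖) * U) (by positivity) (by positivity) hder
      (fun τ hτ => by
        rw [hmode]
        have h3 := hC b U x u hU hx hu τ hτ
        have h4 : ‖Qc (u τ)‖ ≤ ‖Qc‖ * U :=
          (Qc.le_opNorm _).trans (mul_le_mul_of_nonneg_left (hu τ hτ) (norm_nonneg _))
        refine (norm_add_le _ _).trans ?_
        linarith) t ht
    have h5 : ‖Qc (x 0)‖ ≤ ‖Qc‖ * ‖x 0‖ := Qc.le_opNorm _
    rw [← hQc]
    have he := (Real.exp_pos (-α * t)).le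
    have h6 : 0 ≤ Real.exp (-α * t) * ‖x 0‖ := by positivity
    have h7 : 0 ≤ (C + ‖Qc‖) / α * (Real.exp (-α * t) * ‖x 0‖) := by positivity
    have h8 : 0 ≤ (‖Qc‖ + C / α) * U := by positivity
    calc ‖Qc (x t)‖ ≤ _ := h2
      _ ≤ Real.exp (-α * t) * (‖Qc‖ * ‖x 0‖ + C * ‖x 0‖ / α) + (C + ‖Qc‖) * U / α := by gcongr
      _ = (‖Qc‖ + C / α) * (Real.exp (-α * t) * ‖x 0‖) + (C + ‖Qc‖) / α * U := by ring
      _ ≤ _ := by nlinarith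

/-- Linear systems whose matrix has its eigenvalues in the open left half plane are input-to-state
stable, with an exponential rate. -/
lemma exists_decay_of_eigenvalue_re_neg [FiniteDimensional ℂ E] (A : Module.End ℂ E)
    (hA : ∀ l, A.HasEigenvalue l → l.re < 0) :
    ∃ C α : ℝ, 0 ≤ C ∧ 0 < α ∧ ∀ (b U : ℝ) (x u : ℝ → E), 0 ≤ U →
      (∀ t ∈ Icc 0 b, HasDerivWithinAt x (A (x t) + u t) (Icc 0 b) t) →
      (∀ t ∈ Icc 0 b, ‖u t‖ ≤ U) →
      ∀ t ∈ Icc 0 b, ‖x t‖ ≤ C * (Real.exp (-α * t) * ‖x 0‖ + U) := by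
  have hroots : ∀ l ∈ (minpoly ℂ A).roots, l.re < 0 := fun l hl =>
    hA l (Module.End.hasEigenvalue_of_isRoot (Polynomial.isRoot_of_mem_roots hl))
  have hgap : ∀ s : Multiset ℂ, (∀ l ∈ s, l.re < 0) → ∃ α : ℝ, 0 < α ∧ ∀ l ∈ s, l.re ≤ -(2 * α) := by
    intro s
    induction s using Multiset.induction_on with
    | empty => exact fun _ => ⟨1, one_pos, by simp⟩
    | cons l s ih =>
      intro hs
      obtain ⟨α, hα, h⟩ := ih fun l' hl' => hs l' (Multiset.mem_cons_of_mem hl')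
      have hl := hs l (Multiset.mem_cons_self l s)
      refine ⟨min α (-l.re / 2), lt_min hα (by linarith), fun l' hl' => ?_⟩
      rcases Multiset.mem_cons.mp hl' with rfl | hl'
      · linarith [min_le_right α (-l'.re / 2)]
      · linarith [h l' hl', min_le_left α (-l.re / 2)]
  obtain ⟨α, hα, hs⟩ := hgap _ hroots
  have hprod : ((minpoly ℂ A).roots.map fun l => Polynomial.X - Polynomial.C l).prod = minpoly ℂ A :=
    ((IsAlgClosed.splits (minpoly ℂ A)).eq_prod_roots_of_monic
      (minpoly.monic (Algebra.IsIntegral.isIntegral A))).symm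
  obtain ⟨C, hC, h⟩ := exists_decay_of_prod_eq_zero A hα _ hs 1 (by simp)
    (by rw [hprod, minpoly.aeval, zero_mul])
  exact ⟨C, α, hC, hα, by simpa using h⟩

end Decay

section Companion

variable {d : ℕ}

/-- The matrix `ξ ↦ col(ξ₂ - g₁ ξ₁, …, ξ_d - g_{d-1} ξ₁, -g_d ξ₁)` of the linear part of the
internal model in closed loop, over a commutative ring. -/
def companion {R : Type*} [CommRing R] [NeZero d] (g : Fin d → R) : (Fin d → R) →ₗ[R] (Fin d → R) where
  toFun x i := (if h : (i : ℕ) + 1 < d then x ⟨i + 1, h⟩ else 0) - g i * x 0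
  map_add' x y := by
    ext i
    simp only [Pi.add_apply]
    split_ifs <;> ring
  map_smul' a x := by
    ext i
    simp only [Pi.smul_apply, smul_eq_mul, RingHom.id_apply]
    split_ifs <;> ring

/-- The eigenvalues of the matrix with the gains `κ c_{d-1}, …, κ^d c₀` are `κ` times the roots of
`λ^d + c_{d-1} λ^{d-1} + ⋯ + c₀`. -/
lemma companion_eigenvalue_re_neg [NeZero d] {c : Fin d → ℝ} (hc : IsHurwitz c) {κ : ℝ} (hκ : 0 < κ)
    {l : ℂ} (hl : Module.End.HasEigenvalue
      (companion fun i : Fin d => ((κ ^ ((i : ℕ) + 1) * c i.rev : ℝ) : ℂ)) l) : l.re < 0 := by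
  obtain ⟨x, hx⟩ := hl.exists_hasEigenvector
  set g : Fin d → ℂ := fun i => ((κ ^ ((i : ℕ) + 1) * c i.rev : ℝ) : ℂ) with hg
  have hd : 0 < d := Nat.pos_of_ne_zero (NeZero.ne d)
  -- the `j`-th coordinate of the eigenvalue equation, with the coordinates indexed by `ℕ`
  let X : ℕ → ℂ := fun j => if h : j < d then x ⟨j, h⟩ else 0
  let g' : ℕ → ℂ := fun j => if h : j < d then g ⟨j, h⟩ else 0
  have hX0 : X 0 = x 0 := by simp [X, hd]
  have hstep : ∀ j < d, X (j + 1) = l * X j + g' j * X 0 := by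
    intro j hj
    have h1 := congrFun hx.apply_eq_smul ⟨j, hj⟩
    simp only [companion, LinearMap.coe_mk, AddHom.coe_mk, Pi.smul_apply, smul_eq_mul] at h1
    rw [hX0]
    simp only [X, g', hj, dif_pos]
    linear_combination h1
  have hform : ∀ j ≤ d, X j = (l ^ j + ∑ i ∈ Finset.range j, g' i * l ^ (j - 1 - i)) * X 0 := by
    intro j
    induction j with
    | zero => simp
    | succ j ih =>
      intro hj
      rw [hstep j hj, ih (by omega), Finset.sum_range_succ]
      have h2 : ∑ i ∈ Finset.range j, g' i * l ^ (j + 1 - 1 - i)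
          = l * ∑ i ∈ Finset.range j, g' i * l ^ (j - 1 - i) := by
        rw [Finset.mul_sum]
        refine Finset.sum_congr rfl fun i hi => ?_
        rw [show j + 1 - 1 - i = (j - 1 - i) + 1 by have := Finset.mem_range.mp hi; omega, pow_succ]
        ring
      rw [h2]
      simp only [Nat.add_sub_cancel, Nat.sub_self, pow_zero]
      ring
  have hx0 : X 0 ≠ 0 := by
    intro h0
    refine hx.2 (funext fun i => ?_)
    have h3 := hform i i.2.le
    rw [h0, mul_zero] at h3
    simpa [X] using h3
  have hpoly : l ^ d + ∑ i ∈ Finset.range d, g' i * l ^ (d - 1 - i) = 0 := by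
    have h4 := hform d le_rfl
    have h5 : X d = 0 := by simp [X]
    rw [h5] at h4
    exact (mul_eq_zero.mp h4.symm).resolve_right hx0
  have hκ' : (κ : ℂ) ≠ 0 := by exact_mod_cast hκ.ne'
  have hg' : ∀ i : Fin d, g' i = g i := fun i => by simp [g']
  have hroot : (l / κ) ^ d + ∑ i : Fin d, (c i : ℂ) * (l / κ) ^ (i : ℕ) = 0 := by
    have h6 : ∑ i ∈ Finset.range d, g' i * l ^ (d - 1 - i)
        = (κ : ℂ) ^ d * ∑ i : Fin d, (c i : ℂ) * (l / κ) ^ (i : ℕ) := by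
      rw [Finset.sum_range, ← Equiv.sum_comp Fin.revPerm, Finset.mul_sum]
      refine Finset.sum_congr rfl fun i _ => ?_
      have h7 : (κ : ℂ) ^ d = κ ^ (d - (i : ℕ)) * κ ^ (i : ℕ) := by
        rw [← pow_add]; congr 1; omega
      have h8 : d - 1 - (d - ((i : ℕ) + 1)) = i := by omega
      have h9 : d - ((i : ℕ) + 1) + 1 = d - i := by omega
      rw [hg', hg, Fin.revPerm_apply]
      simp only [Fin.rev_rev, Fin.val_rev]
      rw [h8, h9, h7, div_pow]
      push_cast
      field_simp
    rw [h6] at hpoly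
    have h10 : (κ : ℂ) ^ d * ((l / κ) ^ d + ∑ i : Fin d, (c i : ℂ) * (l / κ) ^ (i : ℕ)) = 0 := by
      rw [← hpoly, mul_add, div_pow, mul_div_cancel₀ _ (pow_ne_zero d hκ')]
    exact (mul_eq_zero.mp h10).resolve_left (pow_ne_zero d hκ')
  have h11 := hc _ hroot
  rw [Complex.div_ofReal_re] at h11
  by_contra! h12
  exact absurd (div_nonneg h12 hκ.le) (not_le.mpr h11)

end Companion

/-! ### Reference solutions, tracking error and internal model -/


section Components

variable {E F : Type*} [NormedAddCommGroup E] [NormedSpace ℝ E] [NormedAddCommGroup F]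
  [NormedSpace ℝ F]

lemma hasDerivWithinAt_fst {x : ℝ → E × F} {x' : E × F} {S : Set ℝ} {t : ℝ}
    (h : HasDerivWithinAt x x' S t) : HasDerivWithinAt (fun τ => (x τ).1) x'.1 S t :=
  (ContinuousLinearMap.fst ℝ E F).hasFDerivAt.comp_hasDerivWithinAt t h

lemma hasDerivWithinAt_snd {x : ℝ → E × F} {x' : E × F} {S : Set ℝ} {t : ℝ}
    (h : HasDerivWithinAt x x' S t) : HasDerivWithinAt (fun τ => (x τ).2) x'.2 S t :=
  (ContinuousLinearMap.snd ℝ E F).hasFDerivAt.comp_hasDerivWithinAt t h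

end Components

lemma norm_le_sqrt_mul {m : ℕ} (v : Vec m) {a : ℝ} (ha : 0 ≤ a) (h : ∀ i, |v i| ≤ a) :
    ‖v‖ ≤ Real.sqrt m * a := by
  rw [EuclideanSpace.norm_eq, ← Real.sqrt_sq ha, ← Real.sqrt_mul (Nat.cast_nonneg m)]
  refine Real.sqrt_le_sqrt ?_
  refine (Finset.sum_le_sum fun i _ => (?_ : ‖v i‖ ^ 2 ≤ a ^ 2)).trans (by simp)
  exact pow_le_pow_left₀ (norm_nonneg _) (h i) 2

section Attraction

/-- A set of initial conditions, all of whose solutions stay in one compact set, is attracted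
uniformly by its `ω`-limit set. -/
lemma exists_attraction_time {E : Type*} [NormedAddCommGroup E] [NormedSpace ℝ E] [ProperSpace E]
    {F : E → E} (hF : LocallyLipschitz F) {X C : Set E} (hC : IsCompact C)
    (hXC : ∀ v ∈ X, ∃ x : ℝ → E, IsSolution F x ∧ x 0 = v ∧ ∀ t : ℝ, 0 ≤ t → x t ∈ C)
    {δ : ℝ} (hδ : 0 < δ) :
    ∃ T₁ : ℝ, 0 < T₁ ∧ ∀ x : ℝ → E, IsSolution F x → x 0 ∈ X → ∀ t : ℝ, T₁ ≤ t →
      Metric.infDist (x t) (omegaLimitSet F X) < δ := by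
  let V : {t : ℝ // 0 ≤ t} → Set E := fun t₀ =>
    closure {v : E | ∃ x : ℝ → E, IsSolution F x ∧ x 0 ∈ X ∧ ∃ t : ℝ, (t₀ : ℝ) ≤ t ∧ x t = v}
  have hV : omegaLimitSet F X = ⋂ i, V i := by
    rw [omegaLimitSet, iInter_subtype]
  have hVC : ∀ i, V i ⊆ C := by
    rintro ⟨t₀, ht₀⟩
    refine closure_minimal ?_ hC.isClosed
    rintro _ ⟨x, hx, hx0, t, ht, rfl⟩
    obtain ⟨y, hy, hy0, hyC⟩ := hXC _ hx0
    have h0t : 0 ≤ t := ht₀.trans ht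
    rw [(hx.isSolutionOn t).eqOn hF (hy.isSolutionOn t) hy0.symm ⟨h0t, le_rfl⟩]
    exact hyC t h0t
  have hVc : ∀ i, IsCompact (V i) := fun i => hC.of_isClosed_subset isClosed_closure (hVC i)
  have hdir : Directed (· ⊇ ·) V := by
    have hanti : ∀ i j : {t : ℝ // 0 ≤ t}, i ≤ j → V j ⊆ V i := fun i j hij =>
      closure_mono fun v ⟨x, hx, hx0, t, ht, hv⟩ =>
        ⟨x, hx, hx0, t, le_trans (Subtype.coe_le_coe.mpr hij) ht, hv⟩
    exact fun i j => ⟨i ⊔ j, hanti _ _ le_sup_left, hanti _ _ le_sup_right⟩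
  obtain ⟨i, hi⟩ := exists_subset_nhds_of_isCompact hdir hVc
    (U := {v | Metric.infDist v (omegaLimitSet F X) < δ}) (fun v hv => by
      refine (isOpen_lt (Metric.continuous_infDist_pt _) continuous_const).mem_nhds ?_
      rw [← hV] at hv
      rw [mem_ofPred_eq, Metric.infDist_zero_of_mem hv]
      exact hδ)
  refine ⟨i.1 + 1, by linarith [i.2], fun x hx hx0 t ht => ?_⟩
  exact hi (subset_closure ⟨x, hx, hx0, t, by linarith, rfl⟩)

variable {p r n : ℕ}

lemma locallyLipschitz_f0 {s : Vec r → Vec r} {f : Vec n × ℝ × Vec p → Vec n} {yr : Vec r → ℝ}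
    (hs : LocallyLipschitz s) (hf : ContDiff ℝ 1 f) (hyr : ContDiff ℝ 1 yr) :
    LocallyLipschitz (f0 s f yr : ZState p r n → ZState p r n) := by
  have hw : LocallyLipschitz fun v : ZState p r n => v.2.1 :=
    (contDiff_snd.fst : ContDiff ℝ 1 fun v : ZState p r n => v.2.1).locallyLipschitz
  have h : ContDiff ℝ 1 fun v : ZState p r n => f (v.2.2, yr v.2.1, v.1) :=
    hf.comp (contDiff_snd.snd.prodMk ((hyr.comp contDiff_snd.fst).prodMk contDiff_fst))
  exact (LocallyLipschitz.const 0).prodMk ((hs.comp hw).prodMk h.locallyLipschitz)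

/-- `T₁`, `R`, `δ` are uniform constants for the solutions `ζ` of the zero dynamics that are driven by a
solution `w` of the exosystem in `W` and start in `Z`: such a solution exists for as long as `w` does,
it is bounded by `R`, and after the time `T₁` all points at distance at most `δ` of it are in `Z`. -/
def IsReferenceTube (s : Vec r → Vec r) (f : Vec n × ℝ × Vec p → Vec n) (yr : Vec r → ℝ)
    (P : Set (Vec p)) (W : Set (Vec r)) (Z : Set (Vec n)) (T₁ R δ : ℝ) : Prop :=
  ∀ μ ∈ P, ∀ (b : ℝ) (w : ℝ → Vec r), IsSolutionOn s w b →
    w 0 ∈ W → ∀ z₀ ∈ Z, ∃ ζ : ℝ → Vec n, ζ 0 = z₀ ∧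
      ∀ t ∈ Icc 0 b, HasDerivWithinAt ζ (f (ζ t, yr (w t), μ)) (Icc 0 b) t ∧ ‖ζ t‖ ≤ R ∧
        ∀ v, T₁ ≤ t → ‖v - ζ t‖ ≤ δ → v ∈ Z

/-- A reference tube exists since `ω(P × W × Z)` attracts `P × W × Z` uniformly, and `P × W × Z` is a
neighbourhood of it relative to `P × W × ℝⁿ`. -/
lemma exists_isReferenceTube {s : Vec r → Vec r} {f : Vec n × ℝ × Vec p → Vec n} {yr : Vec r → ℝ}
    (hs : LocallyLipschitz s) (hf : ContDiff ℝ 1 f) (hyr : ContDiff ℝ 1 yr)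
    {W : Set (Vec r)} {P : Set (Vec p)} {Z : Set (Vec n)} (hWinv : IsInvariantSet s W)
    (hstab : HasExpStableSteadyState (f0 s f yr) P W Z) :
    ∃ T₁ R δ : ℝ, 0 < T₁ ∧ 0 ≤ R ∧ 0 < δ ∧ IsReferenceTube s f yr P W Z T₁ R δ := by
  have hF := locallyLipschitz_f0 (p := p) hs hf hyr
  obtain ⟨⟨C, hC, -, hXC⟩, d₁, hd₁, hball, -⟩ := hstab
  obtain ⟨R, hR⟩ := hC.exists_bound_of_continuousOn
    (f := fun v : ZState p r n => v.2.2) (by fun_prop)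
  obtain ⟨T₁, hT₁, hatt⟩ := exists_attraction_time hF hC hXC (half_pos hd₁)
  refine ⟨T₁, max R 0, d₁ / 2, hT₁, le_max_right _ _, half_pos hd₁, ?_⟩
  intro μ hμ b w hw hw0 z₀ hz₀
  obtain ⟨x, hx, hx0, hxC⟩ := hXC (μ, w 0, z₀) ⟨hμ, hw0, hz₀⟩
  have hxb := hx.isSolutionOn b
  have hx1 : EqOn (fun t => (x t).1) (fun _ => μ) (Icc 0 b) :=
    IsSolutionOn.eqOn (F := fun _ => (0 : Vec p)) (LocallyLipschitz.const 0)
      (fun t ht => hasDerivWithinAt_fst (hxb t ht)) (fun t _ => hasDerivWithinAt_const t _ μ)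
      (by simp [hx0])
  have hx2 : EqOn (fun t => (x t).2.1) w (Icc 0 b) :=
    IsSolutionOn.eqOn hs (fun t ht => hasDerivWithinAt_fst (hasDerivWithinAt_snd (hxb t ht))) hw
      (by simp [hx0])
  refine ⟨fun t => (x t).2.2, by simp [hx0], fun t ht => ⟨?_, ?_, ?_⟩⟩
  · have h := hasDerivWithinAt_snd (hasDerivWithinAt_snd (hxb t ht))
    simp only [f0] at h
    rwa [show (x t).2.1 = w t from hx2 ht, show (x t).1 = μ from hx1 ht] at h
  · exact (hR _ (hxC t ht.1)).trans (le_max_left _ _)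
  · intro v hTt hv
    have hxt : x t = (μ, w t, (x t).2.2) :=
      Prod.ext (hx1 ht) (Prod.ext (hx2 ht) rfl)
    have hdist : dist (μ, w t, v) (x t) ≤ d₁ / 2 := by
      rw [hxt, Prod.dist_eq, Prod.dist_eq]
      simpa [dist_eq_norm, (half_pos hd₁).le] using hv
    have hinf := hatt x hx (by rw [hx0]; exact ⟨hμ, hw0, hz₀⟩) t hTt
    refine (hball (μ, w t, v) ⟨hμ, hWinv.mem_of_isSolutionOn hs hw hw0 ht, mem_univ _⟩ ?_).2.2
    have := Metric.infDist_le_infDist_add_dist (s := omegaLimitSet (f0 s f yr) (P ×ˢ W ×ˢ Z))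
      (x := (μ, w t, v)) (y := x t)
    linarith

end Attraction

section Tracking

/-- Gronwall's lemma with a perturbation `L (E₀ e^{-kt/2} + D / k)`, whose integral is `O(1/k)`. -/
lemma norm_le_of_fast_transient {E : Type*} [NormedAddCommGroup E] [NormedSpace ℝ E]
    {v v' : ℝ → E} {b k L E₀ D : ℝ} (hk : 0 < k) (hL : 0 ≤ L) (hE₀ : 0 ≤ E₀) (hD : 0 ≤ D)
    (hv : ∀ t ∈ Icc 0 b, HasDerivWithinAt v (v' t) (Icc 0 b) t) (hv0 : v 0 = 0)
    (hbd : ∀ t ∈ Icc 0 b, ‖v' t‖ ≤ L * (‖v t‖ + (E₀ * Real.exp (-(k / 2) * t) + D / k))) :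
    ∀ t ∈ Icc 0 b, ‖v t‖ ≤ (2 * L * (E₀ + D) + 1) / k * (Real.exp (L * t) * (2 + t)) := by
  intro t ht
  set ε := (2 * L * (E₀ + D) + 1) / k with hε
  have hε0 : 0 < ε := by positivity
  have key := image_norm_le_of_norm_deriv_right_lt_deriv_boundary (f := v) (f' := v')
    (B := fun τ => ε * (Real.exp (L * τ) * (2 - Real.exp (-(k / 2) * τ) + τ)))
    (B' := fun τ => ε * (Real.exp (L * τ) * L * (2 - Real.exp (-(k / 2) * τ) + τ) +
      Real.exp (L * τ) * (k / 2 * Real.exp (-(k / 2) * τ) + 1)))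
    (fun τ hτ => (hv τ hτ).continuousWithinAt)
    (fun τ hτ => hasDerivWithinAt_Ici_of_Icc hτ (hv τ (Ico_subset_Icc_self hτ)))
    (by rw [hv0]; simp; linarith)
    (fun τ => by
      have h1 : HasDerivAt (fun τ => Real.exp (L * τ)) (Real.exp (L * τ) * L) τ := by
        simpa using ((hasDerivAt_id τ).const_mul L).exp
      have h2 : HasDerivAt (fun τ => Real.exp (-(k / 2) * τ))
          (Real.exp (-(k / 2) * τ) * -(k / 2)) τ := by
        simpa using ((hasDerivAt_id τ).const_mul (-(k / 2))).exp
      have h3 := (h1.mul ((h2.const_sub 2).add (hasDerivAt_id τ))).const_mul ε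
      refine h3.congr_deriv ?_
      simp only [Pi.add_apply, id_eq]
      ring)
    (fun τ hτ hτB => by
      have h1 := hbd τ (Ico_subset_Icc_self hτ)
      rw [hτB] at h1
      refine h1.trans_lt ?_
      have hX : 1 ≤ Real.exp (L * τ) := Real.one_le_exp (mul_nonneg hL hτ.1)
      have hY : 0 < Real.exp (-(k / 2) * τ) := Real.exp_pos _
      have hkε : k * ε = 2 * L * (E₀ + D) + 1 := by rw [hε]; field_simp
      have h2 : L * E₀ ≤ ε * (k / 2) := by nlinarith [mul_nonneg hL hD]
      have h3 : L * (D / k) < ε := by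
        rw [hε, ← mul_div_assoc, div_lt_div_iff_of_pos_right hk]
        nlinarith [mul_nonneg hL hD, mul_nonneg hL hE₀]
      have h4 : L * (E₀ * Real.exp (-(k / 2) * τ) + D / k) <
          ε * (k / 2 * Real.exp (-(k / 2) * τ) + 1) := by
        nlinarith [mul_le_mul_of_nonneg_right h2 hY.le]
      have h5 : 0 ≤ ε * (k / 2 * Real.exp (-(k / 2) * τ) + 1) := by positivity
      have h6 := mul_le_mul_of_nonneg_right hX h5
      nlinarith) ht
  refine key.trans (mul_le_mul_of_nonneg_left (mul_le_mul_of_nonneg_left ?_ (Real.exp_pos _).le)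
    hε0.le)
  linarith [Real.exp_pos (-(k / 2) * t)]

/-- The high gain makes the tracking error `O(1/k)` after a fast transient. -/
lemma abs_le_of_high_gain {e h : ℝ → ℝ} {b k D : ℝ} (hk : 0 < k) (hD : 0 ≤ D)
    (he : ∀ t ∈ Icc 0 b, HasDerivWithinAt e (h t - k * e t) (Icc 0 b) t)
    (hh : ∀ t ∈ Icc 0 b, |h t| ≤ D) :
    ∀ t ∈ Icc 0 b, |e t| ≤ |e 0| * Real.exp (-(k / 2) * t) + 2 * D / k := by
  intro t ht
  have h1 := norm_le_of_norm_deriv_sub_smul_le (v := fun τ => (e τ : ℂ)) (l := -(k : ℂ))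
    (α := k / 2) (A := 0) (B := D) (half_pos hk) (by simp; linarith) le_rfl hD
    (fun τ hτ => (he τ hτ).ofReal_comp)
    (fun τ hτ => by
      have : ((h τ - k * e τ : ℝ) : ℂ) - -(k : ℂ) • (e τ : ℂ) = (h τ : ℂ) := by
        push_cast; simp
      rw [this, Complex.norm_real, Real.norm_eq_abs, zero_mul, zero_add]
      exact hh τ hτ) t ht
  simp only [Complex.norm_real, Real.norm_eq_abs, zero_div, add_zero] at h1
  rw [show 2 * D / k = D / (k / 2) by field_simp]
  linarith

end Tracking

section InternalModel

variable {d : ℕ} [NeZero d]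

/-- Uniform estimates of the internal model, in the coordinates `χ = ξ - e G`, over all gains `k`: if the
tracking error satisfies `e' = h + ξ₁ - k e`, with `|e| ≤ E₁` and `|h| ≤ D₁`, then
`|χ(t)| ≤ C (e^{-αt} |χ(0)| + U)`. -/
def IsModelBound (φc : Vec d → ℝ) (G : Vec d) (E₁ D₁ C α U : ℝ) : Prop :=
  ∀ (b k : ℝ) (ξ : ℝ → Vec d) (e h : ℝ → ℝ),
    (∀ t ∈ Icc 0 b, HasDerivWithinAt ξ (PhiC φc (ξ t) - (k * e t) • G) (Icc 0 b) t) →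
    (∀ t ∈ Icc 0 b, HasDerivWithinAt e (h t + ξ t 0 - k * e t) (Icc 0 b) t) →
    (∀ t ∈ Icc 0 b, |e t| ≤ E₁ ∧ |h t| ≤ D₁) →
    ∀ t ∈ Icc 0 b, ‖ξ t - e t • G‖ ≤ C * (Real.exp (-α * t) * ‖ξ 0 - e 0 • G‖ + U)

/-- In the coordinates `χ = ξ - e G` the gain `k` drops out of the internal model: what remains is the
Hurwitz matrix of the gains `G`, with an input that is bounded since `φ_c` is. -/
lemma exists_isModelBound {φc : Vec d → ℝ} {Bφ : ℝ} (hφc : ∀ ξ, |φc ξ| ≤ Bφ) {c : Fin d → ℝ}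
    (hc : IsHurwitz c) {κ : ℝ} (hκ : 0 < κ) {E₁ D₁ : ℝ} (hE₁ : 0 ≤ E₁) (hD₁ : 0 ≤ D₁) :
    ∃ C α U : ℝ, 0 ≤ C ∧ 0 < α ∧ 0 ≤ U ∧ IsModelBound φc (gainG κ c) E₁ D₁ C α U := by
  set G : Vec d := gainG κ c with hG
  set A : Module.End ℂ (Fin d → ℂ) :=
    companion fun i : Fin d => ((κ ^ ((i : ℕ) + 1) * c i.rev : ℝ) : ℂ) with hA
  obtain ⟨C, α, hC, hα, hdecay⟩ := exists_decay_of_eigenvalue_re_neg A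
    fun l hl => companion_eigenvalue_re_neg hc hκ hl
  have hBφ : 0 ≤ Bφ := (abs_nonneg _).trans (hφc 0)
  set U := E₁ * ‖G‖ + Bφ + (D₁ + E₁ * ‖G‖) * ‖G‖ with hU
  have hU0 : 0 ≤ U := by positivity
  refine ⟨Real.sqrt d * C, α, U, by positivity, hα, hU0, ?_⟩
  intro b k ξ e h hξ he hbd t ht
  set χ : ℝ → Vec d := fun t => ξ t - e t • G with hχ
  have hχ' : ∀ τ ∈ Icc 0 b, HasDerivWithinAt χ (PhiC φc (ξ τ) - (h τ + ξ τ 0) • G) (Icc 0 b) τ := by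
    intro τ hτ
    have h1 := (hξ τ hτ).sub ((he τ hτ).smul_const G)
    refine h1.congr_deriv ?_
    rw [sub_smul (h τ + ξ τ 0)]
    abel
  let X : ℝ → Fin d → ℂ := fun τ i => (χ τ i : ℂ)
  let X' : ℝ → Fin d → ℂ := fun τ i => ((PhiC φc (ξ τ) - (h τ + ξ τ 0) • G) i : ℝ)
  have hX : ∀ τ ∈ Icc 0 b, HasDerivWithinAt X (A (X τ) + (X' τ - A (X τ))) (Icc 0 b) τ := by
    intro τ hτ
    rw [add_sub_cancel, hasDerivWithinAt_pi]
    intro i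
    exact ((EuclideanSpace.proj i : Vec d →L[ℝ] ℝ).hasFDerivAt.comp_hasDerivWithinAt τ
      (hχ' τ hτ)).ofReal_comp
  have hGi : ∀ i, |G i| ≤ ‖G‖ := fun i => PiLp.norm_apply_le G i
  have hinput : ∀ τ ∈ Icc 0 b, ‖X' τ - A (X τ)‖ ≤ U := by
    intro τ hτ
    obtain ⟨h1, h2⟩ := hbd τ hτ
    refine (pi_norm_le_iff_of_nonneg hU0).mpr fun i => ?_
    have h3 : (X' τ - A (X τ)) i = (((if hi : (i : ℕ) + 1 < d then e τ * G ⟨i + 1, hi⟩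
        else -φc (ξ τ)) - (h τ + e τ * G 0) * G i : ℝ) : ℂ) := by
      have hGi' : κ ^ ((i : ℕ) + 1) * c i.rev = G i := rfl
      simp only [X', X, hA, companion, Pi.sub_apply, LinearMap.coe_mk, AddHom.coe_mk, hχ, hGi',
        PhiC, PiLp.sub_apply, PiLp.smul_apply, smul_eq_mul]
      split_ifs <;> push_cast <;> ring
    rw [h3, Complex.norm_real, Real.norm_eq_abs]
    have h4 : |(h τ + e τ * G 0) * G i| ≤ (D₁ + E₁ * ‖G‖) * ‖G‖ := by
      rw [abs_mul]
      refine mul_le_mul ((abs_add_le _ _).trans (add_le_add h2 ?_)) (hGi i) (abs_nonneg _)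
        (by positivity)
      rw [abs_mul]
      exact mul_le_mul h1 (hGi 0) (abs_nonneg _) hE₁
    have h5 : |if hi : (i : ℕ) + 1 < d then e τ * G ⟨i + 1, hi⟩ else -φc (ξ τ)| ≤
        E₁ * ‖G‖ + Bφ := by
      split_ifs with hi
      · rw [abs_mul]
        have := mul_le_mul h1 (hGi ⟨i + 1, hi⟩) (abs_nonneg _) hE₁
        linarith
      · rw [abs_neg]
        have : 0 ≤ E₁ * ‖G‖ := by positivity
        linarith [hφc (ξ τ)]
    exact (abs_sub _ _).trans (add_le_add h5 h4)
  have hfin := hdecay b U X (fun τ => X' τ - A (X τ)) hU0 hX hinput t ht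
  have hX0 : ‖X 0‖ ≤ ‖χ 0‖ := (pi_norm_le_iff_of_nonneg (norm_nonneg _)).mpr fun i => by
    rw [Complex.norm_real]
    exact PiLp.norm_apply_le (χ 0) i
  have hXt : ‖χ t‖ ≤ Real.sqrt d * ‖X t‖ := norm_le_sqrt_mul _ (norm_nonneg _) fun i => by
    have := norm_le_pi_norm (X t) i
    rwa [Complex.norm_real] at this
  calc ‖χ t‖ ≤ Real.sqrt d * ‖X t‖ := hXt
    _ ≤ Real.sqrt d * (C * (Real.exp (-α * t) * ‖χ 0‖ + U)) := by
        refine mul_le_mul_of_nonneg_left (hfin.trans ?_) (Real.sqrt_nonneg _)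
        gcongr
    _ = _ := by ring

end InternalModel

/-! ### The closed loop over one sampling period -/


section Period

variable {p r n d : ℕ}

/-- The vector field of the closed loop between two sampling instants, for the state
`(w_d, z, y, ξ)`. -/
def loopField [NeZero d] (s : Vec r → Vec r) (f : Vec n × ℝ × Vec p → Vec n)
    (q : Vec n × ℝ × Vec p → ℝ) (yr : Vec r → ℝ) (φc : Vec d → ℝ) (G : Vec d) (k : ℝ) (μ : Vec p) :
    Vec r × Vec n × ℝ × Vec d → Vec r × Vec n × ℝ × Vec d :=
  fun v => (s v.1, f (v.2.1, v.2.2.1, μ),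
    q (v.2.1, v.2.2.1, μ) + v.2.2.2 0 - k * (v.2.2.1 - yr v.1),
    PhiC φc v.2.2.2 - (k * (v.2.2.1 - yr v.1)) • G)

/-- As long as the tracking error `y - y_r(w)` is `O(e^{-kt/2}) + O(1/k)` with `k` large, the state
`z` of the plant is bounded by the tube around the reference solutions, and belongs to `Z` from
the time `T₁` on. For the second claim, the comparison with a reference solution is restarted at
`t - T₁`, over horizons of length at most `2 T₁`. -/
lemma zero_dynamics_bound {s : Vec r → Vec r} {f : Vec n × ℝ × Vec p → Vec n} {yr : Vec r → ℝ}
    (hs : LocallyLipschitz s) {W : Set (Vec r)} {P : Set (Vec p)} {Z : Set (Vec n)}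
    (hWinv : IsInvariantSet s W) {T₁ R δ : ℝ} (hT₁ : 0 < T₁)
    (href : IsReferenceTube s f yr P W Z T₁ R δ)
    {R₁ Y₁ : ℝ} {L : NNReal} (hR₁ : R ≤ R₁) (hyr : ∀ w ∈ W, |yr w| ≤ Y₁)
    (hL : LipschitzOnWith L f (Metric.closedBall 0 R₁ ×ˢ Metric.closedBall 0 Y₁ ×ˢ P))
    {E₀ D k : ℝ} (hE₀ : 0 ≤ E₀) (hD : 0 ≤ D) (hk : 0 < k)
    (hkδ : (2 * L * (E₀ + D) + 1) / k * (Real.exp (L * (2 * T₁)) * (2 + 2 * T₁)) ≤ δ)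
    {μ : Vec p} (hμ : μ ∈ P) {b : ℝ} {w : ℝ → Vec r} {z : ℝ → Vec n} {y : ℝ → ℝ}
    (hw : IsSolutionOn s w b) (hw0 : w 0 ∈ W) (hz0 : z 0 ∈ Z)
    (hz : ∀ t ∈ Icc 0 b, HasDerivWithinAt z (f (z t, y t, μ)) (Icc 0 b) t)
    (hzy : ∀ t ∈ Icc 0 b, ‖z t‖ ≤ R₁ ∧ |y t| ≤ Y₁)
    (he : ∀ t ∈ Icc 0 b, |y t - yr (w t)| ≤ E₀ * Real.exp (-(k / 2) * t) + D / k) :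
    ∀ t ∈ Icc 0 b, ‖z t‖ ≤ R + δ ∧ (T₁ ≤ t → z t ∈ Z) := by
  have window : ∀ a, 0 ≤ a → z a ∈ Z → ∀ t ∈ Icc a b, t ≤ a + 2 * T₁ →
      ‖z t‖ ≤ R + δ ∧ (a + T₁ ≤ t → z t ∈ Z) := by
    intro a ha hza t ht hta
    have hwa : w a ∈ W := hWinv.mem_of_isSolutionOn hs hw hw0 ⟨ha, ht.1.trans ht.2⟩
    obtain ⟨ζ, hζ0, hζ⟩ := href μ hμ (t - a) (fun τ => w (τ + a))
      ((hw.shift ha).mono (by linarith [ht.2])) (by simpa using hwa) (z a) hza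
    have hmem : ∀ τ ∈ Icc 0 (t - a), τ + a ∈ Icc 0 b := fun τ hτ =>
      ⟨by linarith [hτ.1], by linarith [hτ.2, ht.2]⟩
    have hdist := norm_le_of_fast_transient (v := fun τ => z (τ + a) - ζ τ)
      (v' := fun τ => f (z (τ + a), y (τ + a), μ) - f (ζ τ, yr (w (τ + a)), μ)) (b := t - a)
      (L := L) hk L.2 hE₀ hD
      (fun τ hτ => (hasDerivWithinAt_Icc_shift (hz _ (hmem τ hτ))
        (by rw [sub_add_cancel]; exact Icc_subset_Icc ha ht.2)).sub (hζ τ hτ).1)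
      (by simp [hζ0])
      (fun τ hτ => by
        have hτb := hmem τ hτ
        have hwτ : w (τ + a) ∈ W := hWinv.mem_of_isSolutionOn hs hw hw0 hτb
        have h1 := hL.norm_sub_le (x := (z (τ + a), y (τ + a), μ)) (y := (ζ τ, yr (w (τ + a)), μ))
          ⟨mem_closedBall_zero_iff.mpr (hzy _ hτb).1, mem_closedBall_zero_iff.mpr (hzy _ hτb).2, hμ⟩
          ⟨mem_closedBall_zero_iff.mpr ((hζ τ hτ).2.1.trans hR₁),
            mem_closedBall_zero_iff.mpr (hyr _ hwτ), hμ⟩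
        refine h1.trans (mul_le_mul_of_nonneg_left ?_ L.2)
        have h2 : |y (τ + a) - yr (w (τ + a))| ≤ E₀ * Real.exp (-(k / 2) * τ) + D / k := by
          refine (he _ hτb).trans ?_
          gcongr ?_ * ?_ + _
          exact Real.exp_le_exp.mpr (by nlinarith)
        have h3 : 0 ≤ E₀ * Real.exp (-(k / 2) * τ) + D / k := by positivity
        rw [Prod.mk_sub_mk, Prod.mk_sub_mk, Prod.norm_mk, Prod.norm_mk, sub_self, norm_zero,
          Real.norm_eq_abs]
        refine max_le (by linarith) (max_le ?_ (by positivity))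
        linarith [norm_nonneg (z (τ + a) - ζ τ)])
      (t - a) ⟨by linarith [ht.1], le_rfl⟩
    simp only [sub_add_cancel] at hdist
    have hzζ : ‖z t - ζ (t - a)‖ ≤ δ := by
      refine (hdist.trans ?_).trans hkδ
      have h4 : t - a ≤ 2 * T₁ := by linarith
      have h5 : 0 ≤ t - a := by linarith [ht.1]
      have h6 : (0 : ℝ) ≤ L := L.2
      gcongr
    obtain ⟨-, h7, h8⟩ := hζ (t - a) ⟨by linarith [ht.1], le_rfl⟩
    refine ⟨?_, fun hTt => h8 _ (by linarith) hzζ⟩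
    have := norm_add_le (z t - ζ (t - a)) (ζ (t - a))
    rw [sub_add_cancel] at this
    linarith
  have hind : ∀ j : ℕ, ∀ t ∈ Icc 0 b, t ≤ (j + 2) * T₁ → ‖z t‖ ≤ R + δ ∧ (T₁ ≤ t → z t ∈ Z) := by
    intro j
    induction j with
    | zero =>
      intro t ht htj
      have := window 0 le_rfl hz0 t ht (by simpa using htj)
      rwa [zero_add] at this
    | succ j ih =>
      intro t ht htj
      push_cast at htj
      by_cases htj' : t ≤ (j + 2) * T₁
      · exact ih t ht htj'
      · have hj : (0 : ℝ) ≤ j * T₁ := by positivity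
        have ha : T₁ ≤ t - T₁ := by nlinarith
        have hza := (ih (t - T₁) ⟨by linarith, by linarith [ht.2]⟩ (by nlinarith)).2 ha
        have := window (t - T₁) (by linarith) hza t ⟨by linarith, ht.2⟩ (by linarith)
        exact ⟨this.1, fun _ => this.2 (by linarith)⟩
  intro t ht
  obtain ⟨j, hj⟩ := exists_nat_ge (t / T₁)
  refine hind j t ht ?_
  rw [div_le_iff₀ hT₁] at hj
  linarith

/-- **A priori bounds of the closed loop over one sampling period**, with `e = y - y_r(w)` in place of
`y`. The constants `R + 2δ` and `E₀ + 1` delimit the region in which the bounds `D₁` and `L` of the data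
apply; for large `k` the loop does not leave a smaller region. -/
lemma closed_loop_bound [NeZero d] {s : Vec r → Vec r} {f : Vec n × ℝ × Vec p → Vec n}
    {yr : Vec r → ℝ} (hs : LocallyLipschitz s) {W : Set (Vec r)} {P : Set (Vec p)} {Z : Set (Vec n)}
    (hWinv : IsInvariantSet s W) {φc : Vec d → ℝ} {G : Vec d}
    {T₁ R δ Yr E₀ D₁ C α U X₁ D₂ k : ℝ} {L : NNReal} (hT₁ : 0 < T₁) (hδ : 0 < δ)
    (href : IsReferenceTube s f yr P W Z T₁ R δ) (hYr : ∀ w ∈ W, |yr w| ≤ Yr)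
    (hmodel : IsModelBound φc G (E₀ + 1) D₁ C α U)
    (hL : LipschitzOnWith L f
      (Metric.closedBall 0 (R + 2 * δ) ×ˢ Metric.closedBall 0 (Yr + (E₀ + 1)) ×ˢ P))
    (hE₀ : 0 ≤ E₀) (hC : 0 ≤ C) (hα : 0 ≤ α) (hX₁ : 0 ≤ X₁) (hD₂0 : 0 ≤ D₂)
    (hD₂ : D₁ + (C * (X₁ + U) + (E₀ + 1) * ‖G‖) ≤ D₂) (hk : 0 < k)
    (hkδ : (2 * L * (E₀ + 2 * D₂) + 1) / k * (Real.exp (L * (2 * T₁)) * (2 + 2 * T₁)) ≤ δ)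
    (hkD : 2 * D₂ / k ≤ 1 / 2)
    {μ : Vec p} (hμ : μ ∈ P) {b : ℝ} {w : ℝ → Vec r} {z : ℝ → Vec n} {e h : ℝ → ℝ} {ξ : ℝ → Vec d}
    (hw : IsSolutionOn s w b)
    (hz : ∀ t ∈ Icc 0 b, HasDerivWithinAt z (f (z t, yr (w t) + e t, μ)) (Icc 0 b) t)
    (he : ∀ t ∈ Icc 0 b, HasDerivWithinAt e (h t + ξ t 0 - k * e t) (Icc 0 b) t)
    (hξ : ∀ t ∈ Icc 0 b, HasDerivWithinAt ξ (PhiC φc (ξ t) - (k * e t) • G) (Icc 0 b) t)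
    (hh : ∀ t ∈ Icc 0 b, ‖z t‖ ≤ R + 2 * δ → |e t| ≤ E₀ + 1 → |h t| ≤ D₁)
    (hw0 : w 0 ∈ W) (hz0 : z 0 ∈ Z) (he0 : |e 0| ≤ E₀) (hχ0 : ‖ξ 0 - e 0 • G‖ ≤ X₁) :
    ∀ t ∈ Icc 0 b, ‖ξ t - e t • G‖ ≤ C * (Real.exp (-α * t) * X₁ + U) ∧
      |e t| ≤ E₀ * Real.exp (-(k / 2) * t) + 2 * D₂ / k ∧ |e t| ≤ E₀ + 1 ∧
      ‖z t‖ ≤ R + δ ∧ (T₁ ≤ t → z t ∈ Z) := by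
  -- all estimates, as long as `z` and `e` are in the region
  have est : ∀ a ∈ Icc 0 b, (∀ τ ∈ Icc 0 a, ‖z τ‖ ≤ R + 2 * δ ∧ |e τ| ≤ E₀ + 1) → ∀ t ∈ Icc 0 a,
      ‖ξ t - e t • G‖ ≤ C * (Real.exp (-α * t) * X₁ + U) ∧
      |e t| ≤ E₀ * Real.exp (-(k / 2) * t) + 2 * D₂ / k ∧
      ‖z t‖ ≤ R + δ ∧ (T₁ ≤ t → z t ∈ Z) := by
    intro a ha hreg
    have hsub : Icc 0 a ⊆ Icc 0 b := Icc_subset_Icc_right ha.2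
    have hha : ∀ τ ∈ Icc 0 a, |h τ| ≤ D₁ := fun τ hτ =>
      hh τ (hsub hτ) (hreg τ hτ).1 (hreg τ hτ).2
    have hχ : ∀ τ ∈ Icc 0 a, ‖ξ τ - e τ • G‖ ≤ C * (Real.exp (-α * τ) * X₁ + U) := by
      intro τ hτ
      refine (hmodel a k ξ e h (fun σ hσ => (hξ σ (hsub hσ)).mono hsub)
        (fun σ hσ => (he σ (hsub hσ)).mono hsub) (fun σ hσ => ⟨(hreg σ hσ).2, hha σ hσ⟩)
        τ hτ).trans (mul_le_mul_of_nonneg_left (add_le_add_left ?_ _) hC)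
      exact mul_le_mul_of_nonneg_left hχ0 (Real.exp_pos _).le
    have hin : ∀ τ ∈ Icc 0 a, |h τ + ξ τ 0| ≤ D₂ := by
      intro τ hτ
      have h1 : C * (Real.exp (-α * τ) * X₁ + U) ≤ C * (X₁ + U) :=
        mul_le_mul_of_nonneg_left (add_le_add_left (mul_le_of_le_one_left hX₁
          (Real.exp_le_one_iff.mpr (by nlinarith [hτ.1]))) _) hC
      have h2 := norm_add_le (ξ τ - e τ • G) (e τ • G)
      rw [sub_add_cancel, norm_smul, Real.norm_eq_abs] at h2
      have h3 := mul_le_mul_of_nonneg_right (hreg τ hτ).2 (norm_nonneg G)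
      have h4 : |ξ τ 0| ≤ ‖ξ τ‖ := PiLp.norm_apply_le (ξ τ) 0
      linarith [hχ τ hτ, hha τ hτ, abs_add_le (h τ) (ξ τ 0)]
    have heb : ∀ τ ∈ Icc 0 a, |e τ| ≤ E₀ * Real.exp (-(k / 2) * τ) + 2 * D₂ / k := fun τ hτ =>
      (abs_le_of_high_gain hk hD₂0 (fun σ hσ => (he σ (hsub hσ)).mono hsub) hin τ hτ).trans
        (add_le_add_left (mul_le_mul_of_nonneg_right he0 (Real.exp_pos _).le) _)
    have hzb := zero_dynamics_bound (y := fun τ => yr (w τ) + e τ) hs hWinv hT₁ href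
      (R₁ := R + 2 * δ) (Y₁ := Yr + (E₀ + 1)) (by linarith)
      (fun w hw => (hYr w hw).trans (by linarith)) hL hE₀ (by positivity : 0 ≤ 2 * D₂) hk hkδ hμ
      (hw.mono ha.2) hw0 hz0 (fun τ hτ => (hz τ (hsub hτ)).mono hsub)
      (fun τ hτ => ⟨(hreg τ hτ).1, (abs_add_le _ _).trans
        (add_le_add (hYr _ (hWinv.mem_of_isSolutionOn hs hw hw0 (hsub hτ))) (hreg τ hτ).2)⟩)
      (by simpa using heb)
    exact fun t ht => ⟨hχ t ht, heb t ht, hzb t ht⟩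
  have hcont : ContinuousOn (fun τ => (z τ, e τ)) (Icc 0 b) := fun τ hτ =>
    (hz τ hτ).continuousWithinAt.prodMk (he τ hτ).continuousWithinAt
  have hregion : ∀ t ∈ Icc 0 b, ‖z t‖ ≤ R + 2 * δ ∧ |e t| ≤ E₀ + 1 := by
    intro t ht
    have hz0R : ‖z 0‖ ≤ R := by
      obtain ⟨ζ, hζ0, hζ⟩ := href μ hμ b w hw hw0 (z 0) hz0
      rw [← hζ0]
      exact (hζ 0 ⟨le_rfl, ht.1.trans ht.2⟩).2.1
    have := forall_mem_of_bootstrap hcont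
      (A := Metric.closedBall (0 : Vec n) (R + δ) ×ˢ Metric.closedBall (0 : ℝ) (E₀ + 1 / 2))
      (U := Metric.ball (0 : Vec n) (R + 2 * δ) ×ˢ Metric.ball (0 : ℝ) (E₀ + 1))
      (Metric.isClosed_closedBall.prod Metric.isClosed_closedBall)
      (Metric.isOpen_ball.prod Metric.isOpen_ball)
      (prod_mono (Metric.closedBall_subset_ball (by linarith))
        (Metric.closedBall_subset_ball (by linarith)))
      ⟨mem_ball_zero_iff.mpr (hz0R.trans_lt (by linarith)),
        mem_ball_zero_iff.mpr (he0.trans_lt (by linarith))⟩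
      (fun a ha hreg => by
        obtain ⟨-, h2, h3, -⟩ := est a ha (fun τ hτ => ⟨(mem_ball_zero_iff.mp (hreg τ hτ).1).le,
          (mem_ball_zero_iff.mp (hreg τ hτ).2).le⟩) a ⟨ha.1, le_rfl⟩
        have h4 : E₀ * Real.exp (-(k / 2) * a) ≤ E₀ := mul_le_of_le_one_right hE₀
          (Real.exp_le_one_iff.mpr (by nlinarith [ha.1]))
        exact ⟨mem_closedBall_zero_iff.mpr h3,
          mem_closedBall_zero_iff.mpr (h2.trans (add_le_add h4 hkD))⟩) t ht
    exact ⟨(mem_closedBall_zero_iff.mp this.1).trans (by linarith),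
      (mem_closedBall_zero_iff.mp this.2).trans (by linarith)⟩
  intro t ht
  obtain ⟨h1, h2, h3⟩ := est b ⟨ht.1.trans ht.2, le_rfl⟩ hregion t ht
  exact ⟨h1, h2, (hregion t ht).2, h3⟩

lemma exists_nonneg_bound {X E : Type*} [TopologicalSpace X] [SeminormedAddCommGroup E] {S : Set X}
    (hS : IsCompact S) {g : X → E} (hg : ContinuousOn g S) : ∃ C, 0 ≤ C ∧ ∀ x ∈ S, ‖g x‖ ≤ C := by
  obtain ⟨C, hC⟩ := hS.exists_bound_of_continuousOn hg
  exact ⟨max C 0, le_max_right _ _, fun x hx => (hC x hx).trans (le_max_left _ _)⟩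

lemma mul_exp_le_half {E₀ k t : ℝ} (hk : 0 < k) (hE₀ : 4 * E₀ ≤ k) (ht : 1 ≤ t) :
    E₀ * Real.exp (-(k / 2) * t) ≤ 1 / 2 := by
  have h1 : Real.exp (-(k / 2) * t) * Real.exp (k / 2) ≤ 1 := by
    rw [← Real.exp_add]
    exact Real.exp_le_one_iff.mpr (by nlinarith)
  have h2 : k / 2 ≤ Real.exp (k / 2) := by linarith [Real.add_one_le_exp (k / 2)]
  have h3 : Real.exp (-(k / 2) * t) * (k / 2) ≤ 1 :=
    (mul_le_mul_of_nonneg_left h2 (Real.exp_pos _).le).trans h1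
  linarith [mul_le_mul_of_nonneg_left hE₀ (Real.exp_pos (-(k / 2) * t)).le]

/-- Uniform bounds of the solutions of `x' = F(x)`, `x = (w, z, y, ξ)`, that start in the set given by `W`,
`Z`, `|y| ≤ Y_m` and `|ξ| ≤ R_ξ`; these solutions are back in that set from the time `Ts` on. -/
def IsPeriodBound (F : Vec r × Vec n × ℝ × Vec d → Vec r × Vec n × ℝ × Vec d) (W : Set (Vec r))
    (Z : Set (Vec n)) (Ts Ym Rξ Bz By Bξ : ℝ) : Prop :=
  ∀ (b : ℝ) (w : ℝ → Vec r) (z : ℝ → Vec n) (y : ℝ → ℝ) (ξ : ℝ → Vec d),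
    IsSolutionOn F (fun t => (w t, z t, y t, ξ t)) b →
    w 0 ∈ W → z 0 ∈ Z → |y 0| ≤ Ym → ‖ξ 0‖ ≤ Rξ → ∀ t ∈ Icc 0 b,
      w t ∈ W ∧ ‖z t‖ ≤ Bz ∧ |y t| ≤ By ∧ ‖ξ t‖ ≤ Bξ ∧
        (Ts ≤ t → z t ∈ Z ∧ |y t| ≤ Ym ∧ ‖ξ t‖ ≤ Rξ)

/-- **The closed loop over one sampling period.** There are bounds `Y_m`, `R_ξ` of the initial
values of `y` and `ξ` which hold again, together with `z ∈ Z`, after a time `T*` that depends neither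
on the gain `k` nor on the length of the period. -/
lemma exists_uniform_period_bounds [NeZero d] {s : Vec r → Vec r} {yr : Vec r → ℝ}
    {f : Vec n × ℝ × Vec p → Vec n} {q : Vec n × ℝ × Vec p → ℝ}
    (hs : LocallyLipschitz s) (hyr : ContDiff ℝ 1 yr) (hf : ContDiff ℝ 1 f) (hq : ContDiff ℝ 1 q)
    {W : Set (Vec r)} {P : Set (Vec p)} {Z : Set (Vec n)} {Y : Set ℝ} {Ξ : Set (Vec d)}
    (hW : IsCompact W) (hWinv : IsInvariantSet s W)
    (hP : IsCompact P) (hY : IsCompact Y) (hΞ : IsCompact Ξ)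
    (hstab : HasExpStableSteadyState (f0 s f yr) P W Z)
    {φc : Vec d → ℝ} (hφc : Continuous φc) (hφcs : HasCompactSupport φc)
    {c : Fin d → ℝ} (hc : IsHurwitz c) {κ : ℝ} (hκ : 0 < κ) :
    ∃ Ts ks Ym Rξ Bz By Bξ : ℝ, 0 < Ts ∧ 0 < ks ∧ (∀ y ∈ Y, |y| ≤ Ym) ∧ (∀ ξ ∈ Ξ, ‖ξ‖ ≤ Rξ) ∧
      ∀ k, ks ≤ k → ∀ μ ∈ P,
        IsPeriodBound (loopField s f q yr φc (gainG κ c) k μ) W Z Ts Ym Rξ Bz By Bξ := by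
  obtain ⟨T₁, R, δ, hT₁, hR0, hδ, href⟩ := exists_isReferenceTube hs hf hyr hWinv hstab
  obtain ⟨Yr, hYr0, hYr⟩ : ∃ Yr, 0 ≤ Yr ∧ ∀ w ∈ W, |yr w| ≤ Yr :=
    exists_nonneg_bound hW hyr.continuous.continuousOn
  obtain ⟨Ym, hYm, hYm1⟩ : ∃ Ym, (∀ y ∈ Y, |y| ≤ Ym) ∧ Yr + 1 ≤ Ym := by
    obtain ⟨Y₀, -, hY₀⟩ := exists_nonneg_bound hY continuousOn_id
    exact ⟨max Y₀ (Yr + 1), fun y hy => (hY₀ y hy).trans (le_max_left _ _), le_max_right _ _⟩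
  obtain ⟨Bφ, hBφ⟩ : ∃ Bφ, ∀ ξ, |φc ξ| ≤ Bφ := hφcs.exists_bound_of_continuous hφc
  -- a bound of the initial values of `e = y - y_r(w)`
  obtain ⟨E₀, hE₀⟩ : ∃ E₀, E₀ = Ym + Yr := ⟨_, rfl⟩
  have hE₀0 : 0 ≤ E₀ := by linarith
  -- a bound of the part of `e'` that does not depend on `ξ` and `k`
  obtain ⟨D₁, hD₁0, hD₁⟩ := exists_nonneg_bound
    (g := fun v : Vec n × ℝ × Vec p × Vec r =>
      q (v.1, v.2.1, v.2.2.1) - fderiv ℝ yr v.2.2.2 (s v.2.2.2))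
    ((isCompact_closedBall (0 : Vec n) (R + 2 * δ)).prod
      ((isCompact_closedBall (0 : ℝ) (Yr + (E₀ + 1))).prod (hP.prod hW)))
    (Continuous.continuousOn (by
      have h1 := hyr.continuous_fderiv one_ne_zero
      have h2 := hs.continuous
      have h3 := hq.continuous
      fun_prop))
  obtain ⟨C, α, U, hC, hα, hU, hmodel⟩ := exists_isModelBound hBφ hc hκ
    (E₁ := E₀ + 1) (D₁ := D₁) (by linarith) hD₁0
  generalize gainG κ c = G at *
  -- the terms `C U` and `(E₀ + 1) |G|` bound `ξ` in the long run
  obtain ⟨Rξ, hRξ, hRξ1⟩ : ∃ Rξ, (∀ ξ ∈ Ξ, ‖ξ‖ ≤ Rξ) ∧ C * U + 1 + (E₀ + 1) * ‖G‖ ≤ Rξ := by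
    obtain ⟨X₀, -, hX₀⟩ := exists_nonneg_bound hΞ continuousOn_id
    exact ⟨max X₀ _, fun ξ hξ => (hX₀ ξ hξ).trans (le_max_left _ _), le_max_right _ _⟩
  have hRξ0 : 0 ≤ Rξ := le_trans (by positivity) hRξ1
  obtain ⟨X₁, hX₁⟩ : ∃ X₁, X₁ = Rξ + E₀ * ‖G‖ := ⟨_, rfl⟩
  have hX₁0 : 0 ≤ X₁ := by rw [hX₁]; positivity
  obtain ⟨Bξ, hBξ⟩ : ∃ Bξ, Bξ = C * (X₁ + U) + (E₀ + 1) * ‖G‖ := ⟨_, rfl⟩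
  have hBξ0 : 0 ≤ Bξ := by rw [hBξ]; positivity
  obtain ⟨D₂, hD₂⟩ : ∃ D₂, D₂ = D₁ + Bξ := ⟨_, rfl⟩
  have hD₂0 : 0 ≤ D₂ := by rw [hD₂]; positivity
  obtain ⟨Tχ, hTχ⟩ : ∃ Tχ, ∀ t, Tχ ≤ t → C * (Real.exp (-α * t) * X₁) ≤ 1 := by
    have h1 : Tendsto (fun t : ℝ => C * (Real.exp (-α * t) * X₁)) atTop (𝓝 (C * (0 * X₁))) := by
      refine Tendsto.const_mul _ (Tendsto.mul_const _ (Real.tendsto_exp_atBot.comp ?_))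
      exact tendsto_id.const_mul_atTop_of_neg (by linarith)
    rw [zero_mul, mul_zero] at h1
    exact eventually_atTop.mp (h1.eventually (eventually_le_nhds one_pos))
  obtain ⟨L, hL⟩ := exists_lipschitzOnWith_of_isCompact hf.locallyLipschitz
    ((isCompact_closedBall (0 : Vec n) (R + 2 * δ)).prod
      ((isCompact_closedBall (0 : ℝ) (Yr + (E₀ + 1))).prod hP))
  obtain ⟨Q, hQ⟩ : ∃ Q, Q = (2 * L * (E₀ + 2 * D₂) + 1) *
    (Real.exp (L * (2 * T₁)) * (2 + 2 * T₁)) := ⟨_, rfl⟩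
  have hQ0 : 0 ≤ Q / δ := by
    have : (0 : ℝ) ≤ L := L.2
    rw [hQ]
    positivity
  refine ⟨max (max T₁ Tχ) 1, 1 + 4 * D₂ + 4 * E₀ + Q / δ, Ym, Rξ, R + δ, Yr + (E₀ + 1), Bξ,
    by positivity, by positivity, hYm, hRξ, ?_⟩
  intro k hk μ hμ b w z y ξ hsol hw0 hz0 hy0 hξ0 t ht
  have hk0 : 0 < k := by linarith
  have hkQ : (2 * L * (E₀ + 2 * D₂) + 1) / k * (Real.exp (L * (2 * T₁)) * (2 + 2 * T₁)) ≤ δ := by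
    rw [div_mul_eq_mul_div, ← hQ, div_le_iff₀ hk0, mul_comm, ← div_le_iff₀ hδ]
    linarith
  have hkD : 2 * D₂ / k ≤ 1 / 2 := by
    rw [div_le_iff₀ hk0]; linarith
  have hw : IsSolutionOn s w b := fun t ht => hasDerivWithinAt_fst (hsol t ht)
  have he0 : |y 0 - yr (w 0)| ≤ E₀ :=
    (abs_sub _ _).trans ((add_le_add hy0 (hYr _ hw0)).trans_eq hE₀.symm)
  obtain ⟨h1, h2, h3, h4, h5⟩ := closed_loop_bound hs hWinv hT₁ hδ href hYr hmodel hL hE₀0 hC hα.le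
    hX₁0 hD₂0 (by rw [hD₂, hBξ]) hk0 hkQ hkD hμ hw (z := z) (e := fun t => y t - yr (w t))
    (h := fun t => q (z t, y t, μ) - fderiv ℝ yr (w t) (s (w t))) (ξ := ξ)
    (fun t ht => by
      refine (hasDerivWithinAt_fst (hasDerivWithinAt_snd (hsol t ht))).congr_deriv ?_
      simp only [loopField, add_sub_cancel])
    (fun t ht => by
      have h1 := hasDerivWithinAt_fst (hasDerivWithinAt_snd (hasDerivWithinAt_snd (hsol t ht)))
      have h2 := ((hyr.differentiable one_ne_zero) (w t)).hasFDerivAt.comp_hasDerivWithinAt t (hw t ht)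
      refine (h1.sub h2).congr_deriv ?_
      simp only [loopField]
      ring)
    (fun t ht => hasDerivWithinAt_snd (hasDerivWithinAt_snd (hasDerivWithinAt_snd (hsol t ht))))
    (fun t ht hzt het => by
      refine hD₁ (z t, y t, μ, w t) ⟨mem_closedBall_zero_iff.mpr hzt, mem_closedBall_zero_iff.mpr ?_,
        hμ, hWinv.mem_of_isSolutionOn hs hw hw0 ht⟩
      have h1 := abs_add_le (yr (w t)) (y t - yr (w t))
      rw [add_sub_cancel] at h1
      exact h1.trans (add_le_add (hYr _ (hWinv.mem_of_isSolutionOn hs hw hw0 ht)) het))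
    hw0 hz0 he0
    (by
      refine (norm_sub_le _ _).trans ((add_le_add hξ0 ?_).trans_eq hX₁.symm)
      rw [norm_smul]
      exact mul_le_mul_of_nonneg_right he0 (norm_nonneg _))
    t ht
  have hwW := hWinv.mem_of_isSolutionOn hs hw hw0 ht
  have hy := abs_add_le (yr (w t)) (y t - yr (w t))
  rw [add_sub_cancel] at hy
  have hξ := norm_add_le (ξ t - (y t - yr (w t)) • G) ((y t - yr (w t)) • G)
  rw [sub_add_cancel, norm_smul, Real.norm_eq_abs] at hξ
  have hG := mul_le_mul_of_nonneg_right h3 (norm_nonneg G)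
  refine ⟨hwW, h4, by linarith [hYr _ hwW], ?_, fun hTt => ⟨h5 ?_, ?_, ?_⟩⟩
  · have h6 : C * (Real.exp (-α * t) * X₁ + U) ≤ C * (X₁ + U) :=
      mul_le_mul_of_nonneg_left (add_le_add_left (mul_le_of_le_one_left hX₁0
        (Real.exp_le_one_iff.mpr (by nlinarith [ht.1]))) _) hC
    linarith
  · exact ((le_max_left _ _).trans (le_max_left _ _)).trans hTt
  · have h6 := mul_exp_le_half hk0 (by linarith : 4 * E₀ ≤ k) ((le_max_right _ _).trans hTt)
    linarith [hYr _ hwW]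
  · have h6 := hTχ t (((le_max_right _ _).trans (le_max_left _ _)).trans hTt)
    linarith

end Period

/-! ### The encoder-decoder pair and the trajectories of the closed loop -/


section CoderBounds

variable {r : ℕ}

/-- The quantizer does not saturate: whatever the size of the error before the reset, after the reset
it is at most half a quantization step in every coordinate. -/
lemma abs_sub_reset_le {N : ℕ} (hN : 0 < N) {L : ℝ} (hL : 0 < L) (w wd : Vec r) (i : Fin r) :
    |w i - (wd + (L / N) • quant N L w wd) i| ≤ L / (2 * N) := by
  have hN' : (0 : ℝ) < N := Nat.cast_pos.mpr hN
  set δ := w i - wd i with hδ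
  set a := (N : ℝ) * |δ| / L with ha
  set m : ℝ := if Even N then (⌈a⌉ : ℝ) - 1 / 2 else (⌈a - 1 / 2⌉ : ℝ) with hm
  have ham : |a - m| ≤ 1 / 2 := by
    rw [hm, abs_le]
    split_ifs
    · constructor <;> linarith [Int.le_ceil a, Int.ceil_lt_add_one a]
    · constructor <;> linarith [Int.le_ceil (a - 1 / 2), Int.ceil_lt_add_one (a - 1 / 2)]
  have hsign : |Real.sign δ| ≤ 1 := by
    rcases Real.sign_apply_eq δ with h | h | h <;> rw [h] <;> simp
  have hδa : δ = Real.sign δ * (L / N * a) := by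
    have h1 : L / N * a = |δ| := by rw [ha]; field_simp
    rw [h1]
    rcases lt_trichotomy δ 0 with h | h | h
    · rw [Real.sign_of_neg h, abs_of_neg h]; ring
    · rw [h]; simp
    · rw [Real.sign_of_pos h, abs_of_pos h]; ring
  have h2 : w i - (wd + (L / N) • quant N L w wd) i = Real.sign δ * (L / N * (a - m)) := by
    have h3 : (quant N L w wd) i = Real.sign δ * m := rfl
    rw [PiLp.add_apply, PiLp.smul_apply, h3, smul_eq_mul]
    linear_combination hδa
  rw [h2, abs_mul, abs_mul, abs_of_pos (div_pos hL hN')]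
  calc |Real.sign δ| * (L / N * |a - m|) ≤ 1 * (L / N * (1 / 2)) := by gcongr
    _ = L / (2 * N) := by field_simp

lemma L0_nonneg (W₀ : Set (Vec r)) : 0 ≤ L0 W₀ :=
  Real.sSup_nonneg (by rintro _ ⟨i, x, -, y, -, rfl⟩; exact abs_nonneg _)

lemma Lseq_mem_Icc (W₀ : Set (Vec r)) {N : ℕ} {M : ℝ} (hM : 0 ≤ M) (hMN : Real.sqrt r * M < N)
    (ℓ : ℕ) : Lseq W₀ N M ℓ ∈ Icc 0 (L0 W₀) := by
  have h0 : 0 ≤ Real.sqrt r * (M / N) := by positivity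
  have h1 : Real.sqrt r * (M / N) ≤ 1 := by
    rw [← mul_div_assoc]
    exact div_le_one_of_le₀ hMN.le (Nat.cast_nonneg N)
  induction ℓ with
  | zero => exact ⟨L0_nonneg W₀, le_rfl⟩
  | succ ℓ ih => exact ⟨mul_nonneg h0 ih.1, (mul_le_of_le_one_left ih.1 h1).trans ih.2⟩

/-- The reset of the decoder does not leave `W`, since it leads to a point at distance at most
`√r L₀ / (2 N)` from the state `w ∈ W₀` of the exosystem. -/
lemma reset_mem {W₀ W : Set (Vec r)} {N : ℕ} (hN : 0 < N) (hmargin : IsMargin W₀ W N) {L : ℝ}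
    (hL : L ∈ Icc 0 (L0 W₀)) {w wd : Vec r} (hw : w ∈ W₀) (hwd : wd ∈ W) :
    wd + (L / N) • quant N L w wd ∈ W := by
  rcases hL.1.eq_or_lt with h0 | h0
  · -- for `L = 0` there is no reset
    simpa [← h0] using hwd
  · by_contra hnot
    have h1 := hmargin _ hnot
    have h2 := Metric.infDist_le_dist_of_mem (x := wd + (L / N) • quant N L w wd) hw
    rw [dist_comm, dist_eq_norm] at h2
    have h3 := norm_le_sqrt_mul (w - (wd + (L / N) • quant N L w wd)) (a := L / (2 * N))
      (by positivity) (fun i => abs_sub_reset_le hN h0 w wd i)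
    have h4 : Real.sqrt r * (L / (2 * N)) ≤ Real.sqrt r * (L0 W₀ / (2 * N)) := by
      gcongr
      exact hL.2
    linarith

end CoderBounds

section Trajectories

variable {p r n d : ℕ}

lemma floor_div_eq {T t : ℝ} (hT : 0 < T) {ℓ : ℕ} (ht : t ∈ Ico (ℓ * T) ((ℓ + 1) * T)) :
    ⌊t / T⌋₊ = ℓ := by
  have h0 : 0 ≤ t / T := div_nonneg (le_trans (by positivity) ht.1) hT.le
  rw [Nat.floor_eq_iff h0, le_div_iff₀ hT, div_lt_iff₀ hT]
  exact ht

lemma mem_Ico_floor {T t : ℝ} (hT : 0 < T) (ht : 0 ≤ t) :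
    t ∈ Ico (⌊t / T⌋₊ * T) ((⌊t / T⌋₊ + 1) * T) := by
  rw [mem_Ico, ← le_div_iff₀ hT, ← div_lt_iff₀ hT]
  exact (Nat.floor_eq_iff (div_nonneg ht hT.le)).mp rfl

lemma continuousOn_Ici_of_periods {X : Type*} [TopologicalSpace X] {g : ℝ → X} {T : ℝ} (hT : 0 < T)
    (hg : ∀ ℓ : ℕ, ContinuousOn g (Icc (ℓ * T) ((ℓ + 1) * T))) : ContinuousOn g (Ici 0) := by
  have h : ∀ ℓ : ℕ, ContinuousOn g (Icc 0 (ℓ * T)) := by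
    intro ℓ
    induction ℓ with
    | zero => simp
    | succ ℓ ih =>
      have h1 := ih.union_of_isClosed (hg ℓ) isClosed_Icc isClosed_Icc
      rw [Icc_union_Icc_eq_Icc (by positivity) (by nlinarith)] at h1
      simpa using h1
  intro t ht
  have h2 := mem_Ico_floor hT ht
  refine (h (⌊t / T⌋₊ + 1) t ⟨ht, by push_cast; exact h2.2.le⟩).mono_of_mem_nhdsWithin ?_
  rw [← Ici_inter_Iic]
  refine inter_mem self_mem_nhdsWithin (mem_nhdsWithin_of_mem_nhds (Iic_mem_nhds ?_))
  push_cast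
  exact h2.2

lemma mem_timeDomain_of_le {b : EReal} {t τ : ℝ} (ht : t ∈ timeDomain b) (hτ : 0 ≤ τ) (hτt : τ ≤ t) :
    τ ∈ timeDomain b :=
  ⟨hτ, lt_of_le_of_lt (EReal.coe_le_coe_iff.mpr hτt) ht.2⟩

lemma IsTrajectory.isSolutionOn [NeZero d] {s : Vec r → Vec r} {f : Vec n × ℝ × Vec p → Vec n}
    {q : Vec n × ℝ × Vec p → ℝ} {yr : Vec r → ℝ} {φc : Vec d → ℝ} {G : Vec d} {k T : ℝ} {N : ℕ}
    {L : ℕ → ℝ} {b : EReal} {μ : Vec p} {w wd : ℝ → Vec r} {wdm : ℕ → Vec r} {z : ℝ → Vec n}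
    {y : ℝ → ℝ} {ξ : ℝ → Vec d} (h : IsTrajectory s f q yr φc G k T N L b μ w wd wdm z y ξ)
    (hT : 0 < T) {ℓ : ℕ} {t : ℝ} (ht : t ∈ timeDomain b ∩ Ico (ℓ * T) ((ℓ + 1) * T)) :
    IsSolutionOn (loopField s f q yr φc G k μ)
      (fun τ => (wd (τ + ℓ * T), z (τ + ℓ * T), y (τ + ℓ * T), ξ (τ + ℓ * T))) (t - ℓ * T) := by
  intro τ hτ
  have hℓ : (0 : ℝ) ≤ ℓ * T := by positivity
  have hmem : τ + ℓ * T ∈ timeDomain b ∩ Ico (ℓ * T) ((ℓ + 1) * T) :=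
    ⟨mem_timeDomain_of_le ht.1 (by linarith [hτ.1]) (by linarith [hτ.2]),
      by linarith [hτ.1], by linarith [hτ.2, ht.2.2]⟩
  have hsub : Icc (ℓ * T) (t - ℓ * T + ℓ * T) ⊆ Ico (ℓ * T) ((ℓ + 1) * T) := by
    rw [sub_add_cancel]
    exact fun σ hσ => ⟨hσ.1, hσ.2.trans_lt ht.2.2⟩
  exact (hasDerivWithinAt_Icc_shift (h.wd_flow ℓ _ hmem) hsub).prodMk
    ((hasDerivWithinAt_Icc_shift (h.z_flow ℓ _ hmem) hsub).prodMk
      ((hasDerivWithinAt_Icc_shift (h.y_flow ℓ _ hmem) hsub).prodMk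
        (hasDerivWithinAt_Icc_shift (h.ξ_flow ℓ _ hmem) hsub)))

/-- The estimates over one period carry over from sampling instant to sampling instant: at the end of
a period longer than `Ts` the left limit of the state is in the set in which the period started, and
the reset, which changes `w_d` only, does not leave it. -/
lemma IsTrajectory.bounds [NeZero d] {s : Vec r → Vec r} {f : Vec n × ℝ × Vec p → Vec n}
    {q : Vec n × ℝ × Vec p → ℝ} {yr : Vec r → ℝ} {φc : Vec d → ℝ} {G : Vec d} {k T : ℝ} {N : ℕ}
    {L : ℕ → ℝ} {b : EReal} {μ : Vec p} {w wd : ℝ → Vec r} {wdm : ℕ → Vec r} {z : ℝ → Vec n}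
    {y : ℝ → ℝ} {ξ : ℝ → Vec d} (h : IsTrajectory s f q yr φc G k T N L b μ w wd wdm z y ξ)
    {W : Set (Vec r)} {Z : Set (Vec n)} {Ts Ym Rξ Bz By Bξ : ℝ}
    (hper : IsPeriodBound (loopField s f q yr φc G k μ) W Z Ts Ym Rξ Bz By Bξ)
    (hW : IsClosed W) (hZ : IsClosed Z) (hTs : 0 < Ts) (hT : Ts < T)
    (hreset : ∀ ℓ : ℕ, ∀ v ∈ W, v + (L ℓ / N) • quant N (L ℓ) (w (ℓ * T)) v ∈ W)
    (hwd0 : wd 0 ∈ W) (hz0 : z 0 ∈ Z) (hy0 : |y 0| ≤ Ym) (hξ0 : ‖ξ 0‖ ≤ Rξ) :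
    (∀ t ∈ timeDomain b, wd t ∈ W ∧ ‖z t‖ ≤ Bz ∧ |y t| ≤ By ∧ ‖ξ t‖ ≤ Bξ) ∧
    ∀ ℓ : ℕ, (ℓ * T : ℝ) ∈ timeDomain b → wd (ℓ * T) ∈ W ∧ (1 ≤ ℓ → wdm ℓ ∈ W) ∧
      z (ℓ * T) ∈ Z ∧ |y (ℓ * T)| ≤ Ym ∧ ‖ξ (ℓ * T)‖ ≤ Rξ := by
  have hT0 : 0 < T := hTs.trans hT
  have hperiod : ∀ ℓ : ℕ, (wd (ℓ * T) ∈ W ∧ z (ℓ * T) ∈ Z ∧ |y (ℓ * T)| ≤ Ym ∧ ‖ξ (ℓ * T)‖ ≤ Rξ) →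
      ∀ t ∈ timeDomain b ∩ Ico (ℓ * T) ((ℓ + 1) * T),
        wd t ∈ W ∧ ‖z t‖ ≤ Bz ∧ |y t| ≤ By ∧ ‖ξ t‖ ≤ Bξ ∧
          (Ts + ℓ * T ≤ t → z t ∈ Z ∧ |y t| ≤ Ym ∧ ‖ξ t‖ ≤ Rξ) := by
    rintro ℓ ⟨h1, h2, h3, h4⟩ t ht
    have h5 := hper _ _ _ _ _ (h.isSolutionOn hT0 ht) (by simpa using h1) (by simpa using h2)
      (by simpa using h3) (by simpa using h4) (t - ℓ * T) ⟨by linarith [ht.2.1], le_rfl⟩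
    simp only [sub_add_cancel] at h5
    exact ⟨h5.1, h5.2.1, h5.2.2.1, h5.2.2.2.1, fun hTt => h5.2.2.2.2 (by linarith)⟩
  have hsample : ∀ ℓ : ℕ, (ℓ * T : ℝ) ∈ timeDomain b → wd (ℓ * T) ∈ W ∧ (1 ≤ ℓ → wdm ℓ ∈ W) ∧
      z (ℓ * T) ∈ Z ∧ |y (ℓ * T)| ≤ Ym ∧ ‖ξ (ℓ * T)‖ ≤ Rξ := by
    intro ℓ
    induction ℓ with
    | zero =>
      intro _
      simpa using ⟨hwd0, hz0, hy0, hξ0⟩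
    | succ ℓ ih =>
      intro hℓ
      have hcast : ((ℓ + 1 : ℕ) : ℝ) * T = (ℓ + 1) * T := by push_cast; ring
      set c : ℝ := ((ℓ + 1 : ℕ) : ℝ) * T with hc
      have hℓT : (0 : ℝ) ≤ ℓ * T := by positivity
      have hc0 : 0 < c := by rw [hcast]; nlinarith
      obtain ⟨h1, -, h2⟩ := ih (mem_timeDomain_of_le hℓ hℓT (by rw [hcast]; nlinarith))
      have hmem : ∀ t ∈ Ico (ℓ * T) c, t ∈ timeDomain b ∩ Ico (ℓ * T) ((ℓ + 1) * T) := fun t ht =>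
        ⟨mem_timeDomain_of_le hℓ (hℓT.trans ht.1) ht.2.le, ht.1, hcast ▸ ht.2⟩
      have hIco : Ico (Ts + ℓ * T) c ∈ 𝓝[<] c := Ico_mem_nhdsLT (by rw [hcast]; nlinarith)
      have hlim : ∀ t ∈ Ico (Ts + ℓ * T) c, wd t ∈ W ∧ z t ∈ Z ∧ |y t| ≤ Ym ∧ ‖ξ t‖ ≤ Rξ := by
        intro t ht
        obtain ⟨h3, -, -, -, h4⟩ := hperiod ℓ ⟨h1, h2⟩ t (hmem t ⟨by linarith [ht.1], ht.2⟩)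
        exact ⟨h3, h4 ht.1⟩
      have hdom : Ico 0 c ⊆ timeDomain b := fun t ht => mem_timeDomain_of_le hℓ ht.1 ht.2.le
      have hleft : 𝓝[<] c ≤ 𝓝[timeDomain b] c := by
        rw [← nhdsWithin_Ico_eq_nhdsLT hc0]
        exact nhdsWithin_mono _ hdom
      have hz : Tendsto z (𝓝[<] c) (𝓝 (z c)) := (h.z_cont c hℓ).mono_left hleft
      have hy : Tendsto y (𝓝[<] c) (𝓝 (y c)) := (h.y_cont c hℓ).mono_left hleft
      have hξ : Tendsto ξ (𝓝[<] c) (𝓝 (ξ c)) := (h.ξ_cont c hℓ).mono_left hleft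
      have hwdm : wdm (ℓ + 1) ∈ W := hW.mem_of_tendsto (h.wd_left (ℓ + 1) (by omega) hℓ)
        (mem_of_superset hIco fun t ht => (hlim t ht).1)
      refine ⟨?_, fun _ => hwdm, hZ.mem_of_tendsto hz (mem_of_superset hIco fun t ht => (hlim t ht).2.1),
        le_of_tendsto hy.abs (mem_of_superset hIco fun t ht => (hlim t ht).2.2.1),
        le_of_tendsto hξ.norm (mem_of_superset hIco fun t ht => (hlim t ht).2.2.2)⟩
      rw [h.wd_reset (ℓ + 1) (by omega) hℓ]
      exact hreset (ℓ + 1) _ hwdm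
  refine ⟨fun t ht => ?_, hsample⟩
  have hfl := mem_Ico_floor hT0 ht.1
  obtain ⟨h1, -, h2⟩ := hsample ⌊t / T⌋₊ (mem_timeDomain_of_le ht (by positivity) hfl.1)
  obtain ⟨h3, h4, h5, h6, -⟩ := hperiod ⌊t / T⌋₊ ⟨h1, h2⟩ t ⟨ht, hfl⟩
  exact ⟨h3, h4, h5, h6⟩

lemma locallyLipschitz_loopField [NeZero d] {s : Vec r → Vec r} {yr : Vec r → ℝ}
    {f : Vec n × ℝ × Vec p → Vec n} {q : Vec n × ℝ × Vec p → ℝ} (hs : LocallyLipschitz s)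
    (hyr : ContDiff ℝ 1 yr) (hf : ContDiff ℝ 1 f) (hq : ContDiff ℝ 1 q) {φc : Vec d → ℝ}
    (hφc : LocallyLipschitz φc) (G : Vec d) (k : ℝ) (μ : Vec p) :
    LocallyLipschitz (loopField s f q yr φc G k μ) := by
  -- the field is a continuously differentiable function of the state and of the value `a` of `φ_c`,
  -- apart from its first component
  have hPhi : ContDiff ℝ 1 fun v : Vec d × ℝ => PhiC (fun _ => v.2) v.1 := by
    rw [contDiff_euclidean]
    intro i
    simp only [PhiC]
    split_ifs <;> fun_prop
  have hw : ContDiff ℝ 1 fun v : Vec r × Vec n × ℝ × Vec d => v.1 := contDiff_fst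
  have hz : ContDiff ℝ 1 fun v : Vec r × Vec n × ℝ × Vec d => v.2.1 := contDiff_snd.fst
  have hy : ContDiff ℝ 1 fun v : Vec r × Vec n × ℝ × Vec d => v.2.2.1 := contDiff_snd.snd.fst
  have hξ : ContDiff ℝ 1 fun v : Vec r × Vec n × ℝ × Vec d => v.2.2.2 := contDiff_snd.snd.snd
  have hξ0 : ContDiff ℝ 1 fun v : Vec r × Vec n × ℝ × Vec d => v.2.2.2 0 :=
    (EuclideanSpace.proj (0 : Fin d) : Vec d →L[ℝ] ℝ).contDiff.comp hξ
  have hzy : ContDiff ℝ 1 fun v : Vec r × Vec n × ℝ × Vec d => (v.2.1, v.2.2.1, μ) :=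
    hz.prodMk (hy.prodMk contDiff_const)
  have he : ContDiff ℝ 1 fun v : Vec r × Vec n × ℝ × Vec d => k * (v.2.2.1 - yr v.1) :=
    contDiff_const.mul (hy.sub (hyr.comp hw))
  have h1 := hs.comp hw.locallyLipschitz
  have h2 := (hf.comp hzy).locallyLipschitz
  have h3 := (((hq.comp hzy).add hξ0).sub he).locallyLipschitz
  have h4 := hPhi.locallyLipschitz.comp
    (hξ.locallyLipschitz.prodMk (hφc.comp hξ.locallyLipschitz))
  have h5 := (he.smul (contDiff_const (c := G))).locallyLipschitz
  have h6 := (contDiff_fst.sub contDiff_snd :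
    ContDiff ℝ 1 fun v : Vec d × Vec d => v.1 - v.2).locallyLipschitz.comp (h4.prodMk h5)
  exact h1.prodMk (h2.prodMk (h3.prodMk h6))

lemma IsPeriodBound.exists_isSolutionOn
    {F : Vec r × Vec n × ℝ × Vec d → Vec r × Vec n × ℝ × Vec d} (hF : LocallyLipschitz F)
    {W : Set (Vec r)} {Z : Set (Vec n)} {Ts Ym Rξ Bz By Bξ : ℝ}
    (hper : IsPeriodBound F W Z Ts Ym Rξ Bz By Bξ) (hW : IsCompact W) {T : ℝ} (hT : 0 ≤ T)
    {v : Vec r × Vec n × ℝ × Vec d}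
    (hv : v ∈ W ×ˢ Z ×ˢ Metric.closedBall 0 Ym ×ˢ Metric.closedBall 0 Rξ) :
    ∃ x : ℝ → Vec r × Vec n × ℝ × Vec d, IsSolutionOn F x T ∧ x 0 = v := by
  obtain ⟨Bw, hBw⟩ : ∃ Bw, ∀ w ∈ W, ‖w‖ ≤ Bw := hW.exists_bound_of_continuousOn continuousOn_id
  refine exists_isSolutionOn_of_bound (ρ := max Bw (max Bz (max By Bξ))) hF hT ?_
  intro c hc x hx hx0
  obtain ⟨h1, h2, h3, h4⟩ := hv
  obtain ⟨h5, h6, h7, h8, -⟩ := hper c (fun t => (x t).1) (fun t => (x t).2.1) (fun t => (x t).2.2.1)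
    (fun t => (x t).2.2.2) hx (by simpa [hx0] using h1) (by simpa [hx0] using h2)
    (by simpa [hx0] using h3) (by simpa [hx0] using h4) c ⟨hc.1, le_rfl⟩
  exact max_le_max (hBw _ h5) (max_le_max h6 (max_le_max h7 h8))

/-- A trajectory for all positive times is obtained from solutions on the single periods, each of them
started at the reset of the end of the previous one. -/
lemma exists_isTrajectory [NeZero d] {s : Vec r → Vec r} {yr : Vec r → ℝ}
    {f : Vec n × ℝ × Vec p → Vec n} {q : Vec n × ℝ × Vec p → ℝ} {φc : Vec d → ℝ} {G : Vec d} {k : ℝ}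
    {μ : Vec p} (hF : LocallyLipschitz (loopField s f q yr φc G k μ))
    {W : Set (Vec r)} {Z : Set (Vec n)} {Ts Ym Rξ Bz By Bξ : ℝ}
    (hper : IsPeriodBound (loopField s f q yr φc G k μ) W Z Ts Ym Rξ Bz By Bξ)
    (hW : IsCompact W) (hTs : 0 < Ts) {T : ℝ} (hT : Ts < T) {N : ℕ} {L : ℕ → ℝ}
    {w : ℝ → Vec r} (hw : IsSolution s w)
    (hreset : ∀ ℓ : ℕ, ∀ v ∈ W, v + (L ℓ / N) • quant N (L ℓ) (w (ℓ * T)) v ∈ W)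
    {wd₀ : Vec r} {z₀ : Vec n} {y₀ : ℝ} {ξ₀ : Vec d}
    (h₀ : (wd₀, z₀, y₀, ξ₀) ∈ W ×ˢ Z ×ˢ Metric.closedBall 0 Ym ×ˢ Metric.closedBall 0 Rξ) :
    ∃ (wd : ℝ → Vec r) (wdm : ℕ → Vec r) (z : ℝ → Vec n) (y : ℝ → ℝ) (ξ : ℝ → Vec d),
      IsTrajectory s f q yr φc G k T N L ⊤ μ w wd wdm z y ξ ∧
        wd 0 = wd₀ ∧ z 0 = z₀ ∧ y 0 = y₀ ∧ ξ 0 = ξ₀ := by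
  have hT0 : 0 < T := hTs.trans hT
  have hex := fun v (hv : v ∈ W ×ˢ Z ×ˢ Metric.closedBall 0 Ym ×ˢ Metric.closedBall 0 Rξ) =>
    hper.exists_isSolutionOn hF hW hT0.le hv
  -- `sol v` is a solution on `[0, T]` from `v`, and `st ℓ` is the state at the instant `ℓ T`
  choose! sol hsol hsol0 using hex
  let st : ℕ → Vec r × Vec n × ℝ × Vec d := fun ℓ => Nat.rec (wd₀, z₀, y₀, ξ₀) (fun j v =>
    ((sol v T).1 + (L (j + 1) / N) • quant N (L (j + 1)) (w ((j + 1 : ℕ) * T)) (sol v T).1,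
      (sol v T).2)) ℓ
  have hst : ∀ ℓ, st ℓ ∈ W ×ˢ Z ×ˢ Metric.closedBall 0 Ym ×ˢ Metric.closedBall 0 Rξ := by
    intro ℓ
    induction ℓ with
    | zero => exact h₀
    | succ j ih =>
      obtain ⟨h1, h2, h3, h4⟩ := id ih
      have h0 := hsol0 (st j) ih
      obtain ⟨h5, -, -, -, h6⟩ := hper T (fun t => (sol (st j) t).1) (fun t => (sol (st j) t).2.1)
        (fun t => (sol (st j) t).2.2.1) (fun t => (sol (st j) t).2.2.2) (hsol _ ih)
        (by simpa [h0] using h1) (by simpa [h0] using h2) (by simpa [h0] using h3)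
        (by simpa [h0] using h4) T ⟨hT0.le, le_rfl⟩
      obtain ⟨h7, h8, h9⟩ := h6 hT.le
      exact ⟨hreset (j + 1) _ h5, h7, mem_closedBall_zero_iff.mpr h8, mem_closedBall_zero_iff.mpr h9⟩
  let x : ℝ → Vec r × Vec n × ℝ × Vec d := fun t => sol (st ⌊t / T⌋₊) (t + -(⌊t / T⌋₊ * T))
  have hx : ∀ ℓ : ℕ, ∀ t ∈ Ico (ℓ * T) ((ℓ + 1) * T), x t = sol (st ℓ) (t + -(ℓ * T)) := by
    intro ℓ t ht
    simp only [x]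
    rw [floor_div_eq hT0 ht]
  have hmaps : ∀ ℓ : ℕ, MapsTo (fun t : ℝ => t + -(ℓ * T)) (Icc (ℓ * T) ((ℓ + 1) * T)) (Icc 0 T) :=
    fun ℓ t ht => ⟨by linarith [ht.1], by linarith [ht.2]⟩
  have hpiece : ∀ ℓ : ℕ, ContinuousOn (fun t => sol (st ℓ) (t + -(ℓ * T)))
      (Icc (ℓ * T) ((ℓ + 1) * T)) := fun ℓ =>
    (hsol _ (hst ℓ)).continuousOn.comp (by fun_prop) (hmaps ℓ)
  have hflow : ∀ ℓ : ℕ, ∀ t ∈ timeDomain ⊤ ∩ Ico (ℓ * T) ((ℓ + 1) * T),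
      HasDerivWithinAt x (loopField s f q yr φc G k μ (x t)) (Ico (ℓ * T) ((ℓ + 1) * T)) t := by
    rintro ℓ t ⟨-, ht⟩
    have h1 := hasDerivWithinAt_comp_add (S' := Ico (ℓ * T) ((ℓ + 1) * T))
      (hsol _ (hst ℓ) (t + -(ℓ * T)) (hmaps ℓ (Ico_subset_Icc_self ht)))
      ((hmaps ℓ).mono_left Ico_subset_Icc_self)
    rw [← hx ℓ t ht] at h1
    exact h1.congr (hx ℓ) (hx ℓ t ht)
  have hxT : ∀ ℓ : ℕ, x (ℓ * T) = st ℓ := by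
    intro ℓ
    rw [hx ℓ (ℓ * T) ⟨le_rfl, by nlinarith⟩, add_neg_cancel, hsol0 _ (hst ℓ)]
  have hcont : ContinuousOn (fun t => (x t).2) (timeDomain ⊤) := by
    refine (continuousOn_Ici_of_periods hT0 fun ℓ => ?_).mono fun t ht => ht.1
    refine (continuous_snd.comp_continuousOn (hpiece ℓ)).congr fun t ht => ?_
    rcases ht.2.lt_or_eq with hlt | heq
    · simp only [Function.comp_apply]
      rw [hx ℓ t ⟨ht.1, hlt⟩]
    · have h1 : t = ((ℓ + 1 : ℕ) : ℝ) * T := by rw [heq]; push_cast; ring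
      have h2 : t + -(ℓ * T) = T := by rw [heq]; ring
      simp only [Function.comp_apply]
      rw [h2, h1, hxT]
  have hx0 : x 0 = (wd₀, z₀, y₀, ξ₀) := by
    have h := hxT 0
    rwa [Nat.cast_zero, zero_mul] at h
  refine ⟨fun t => (x t).1, fun ℓ => (sol (st (ℓ - 1)) T).1, fun t => (x t).2.1, fun t => (x t).2.2.1,
    fun t => (x t).2.2.2, ?_, by simp [hx0], by simp [hx0], by simp [hx0], by simp [hx0]⟩
  exact
    { exo := hw
      wd_flow := fun ℓ t ht => hasDerivWithinAt_fst (hflow ℓ t ht)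
      z_flow := fun ℓ t ht => hasDerivWithinAt_fst (hasDerivWithinAt_snd (hflow ℓ t ht))
      y_flow := fun ℓ t ht => hasDerivWithinAt_fst
        (hasDerivWithinAt_snd (hasDerivWithinAt_snd (hflow ℓ t ht)))
      ξ_flow := fun ℓ t ht => hasDerivWithinAt_snd
        (hasDerivWithinAt_snd (hasDerivWithinAt_snd (hflow ℓ t ht)))
      z_cont := continuous_fst.comp_continuousOn hcont
      y_cont := (continuous_fst.comp continuous_snd).comp_continuousOn hcont
      ξ_cont := (continuous_snd.comp continuous_snd).comp_continuousOn hcont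
      wd_left := fun ℓ hℓ _ => by
        obtain ⟨j, rfl⟩ : ∃ j, ℓ = j + 1 := ⟨ℓ - 1, by omega⟩
        have hc : ((j + 1 : ℕ) : ℝ) * T = (j + 1) * T := by push_cast; ring
        have hlt : (j : ℝ) * T < (j + 1) * T := by nlinarith
        have h1 := (hpiece j ((j + 1) * T) ⟨hlt.le, le_rfl⟩).mono_left
          (nhdsWithin_mono _ Ico_subset_Icc_self)
        rw [nhdsWithin_Ico_eq_nhdsLT hlt] at h1
        have h2 : (j + 1) * T + -(j * T) = T := by ring
        rw [hc, Nat.add_sub_cancel]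
        simp only [h2] at h1
        refine ((continuous_fst.tendsto _).comp h1).congr' ?_
        filter_upwards [Ico_mem_nhdsLT hlt] with t ht
        simp only [Function.comp_apply]
        rw [hx j t ht]
      wd_reset := fun ℓ hℓ _ => by
        obtain ⟨j, rfl⟩ : ∃ j, ℓ = j + 1 := ⟨ℓ - 1, by omega⟩
        simp only [hxT, Nat.add_sub_cancel]
        rfl }

end Trajectories

end RemoteTracking

theorem proposition2 {p r n d : ℕ} [NeZero d]
    -- the exosystem, its output, and the plant
    (s : RemoteTracking.Vec r → RemoteTracking.Vec r)
    (yr : RemoteTracking.Vec r → ℝ)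
    (f : RemoteTracking.Vec n × ℝ × RemoteTracking.Vec p → RemoteTracking.Vec n)
    (q : RemoteTracking.Vec n × ℝ × RemoteTracking.Vec p → ℝ)
    (hs : LocallyLipschitz s) (hyr : ContDiff ℝ 1 yr) (hf : ContDiff ℝ 1 f) (hq : ContDiff ℝ 1 q)
    -- the sets of parameters and of initial conditions
    (W₀ W : Set (RemoteTracking.Vec r)) (P : Set (RemoteTracking.Vec p))
    (Z : Set (RemoteTracking.Vec n)) (Y : Set ℝ) (Ξ : Set (RemoteTracking.Vec d))
    (hW₀ : IsCompact W₀) (hW₀inv : RemoteTracking.IsInvariantSet s W₀)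
    (hW : IsCompact W) (hWinv : RemoteTracking.IsInvariantSet s W) (hWW : W₀ ⊆ W)
    (hP : IsCompact P) (hZ : IsCompact Z) (hY : IsCompact Y) (hΞ : IsCompact Ξ)
    -- the locally exponentially stable steady state set
    (hstab : RemoteTracking.HasExpStableSteadyState (RemoteTracking.f0 s f yr) P W Z)
    -- the map `τ` is well defined and continuously differentiable
    (hτ : ∀ i : ℕ, i < d → ContDiff ℝ 1
      (RemoteTracking.lieIter (RemoteTracking.f0 s f yr) (RemoteTracking.q0 s q yr) i))
    -- the immersion and the internal model
    (φ : RemoteTracking.Vec d → ℝ) (hφ : LocallyLipschitz φ)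
    (himm : RemoteTracking.HasImmersion (RemoteTracking.f0 s f yr) (RemoteTracking.q0 s q yr)
      (RemoteTracking.omegaLimitSet (RemoteTracking.f0 s f yr) (P ×ˢ W ×ˢ Z)) d φ)
    (φc : RemoteTracking.Vec d → ℝ) (hφc : LocallyLipschitz φc) (hφcs : HasCompactSupport φc)
    (hφφ : Set.EqOn φc φ
      (RemoteTracking.tau (RemoteTracking.f0 s f yr) (RemoteTracking.q0 s q yr) d ''
        RemoteTracking.omegaLimitSet (RemoteTracking.f0 s f yr) (P ×ˢ W ×ˢ Z)))
    (c : Fin d → ℝ) (hc : RemoteTracking.IsHurwitz c) :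
    ∃ κs : ℝ, 0 < κs ∧ ∀ κ : ℝ, κs ≤ κ →
      ∃ Ts ks : ℝ, 0 < Ts ∧ 0 < ks ∧
      ∃ K B : Set (RemoteTracking.LoopState p r n d), IsCompact K ∧ IsCompact B ∧
        P ×ˢ W ×ˢ Z ×ˢ Y ×ˢ Ξ ⊆ K ∧
        K ⊆ P ×ˢ W ×ˢ Z ×ˢ (Set.univ : Set ℝ) ×ˢ (Set.univ : Set (RemoteTracking.Vec d)) ∧
        ∀ T : ℝ, Ts < T → ∀ k : ℝ, ks ≤ k →
        -- any admissible number of quantization levels and any growth bound of the exosystem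
        ∀ N : ℕ, 0 < N → RemoteTracking.IsMargin W₀ W N →
        ∀ M : ℝ → ℝ, RemoteTracking.IsGrowthBound s W M → Real.sqrt r * M T < N →
          -- from all initial conditions there is a trajectory for all positive times
          (∀ w₀ ∈ W₀, ∀ μ ∈ P, ∀ wd₀ ∈ W, ∀ z₀ ∈ Z, ∀ y₀ ∈ Y, ∀ ξ₀ ∈ Ξ,
            ∃ (w wd : ℝ → RemoteTracking.Vec r) (wdm : ℕ → RemoteTracking.Vec r)
              (z : ℝ → RemoteTracking.Vec n) (y : ℝ → ℝ) (ξ : ℝ → RemoteTracking.Vec d),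
              RemoteTracking.IsTrajectory s f q yr φc (RemoteTracking.gainG κ c) k T N
                (RemoteTracking.Lseq W₀ N (M T)) ⊤ μ w wd wdm z y ξ ∧
              w 0 = w₀ ∧ wd 0 = wd₀ ∧ z 0 = z₀ ∧ y 0 = y₀ ∧ ξ 0 = ξ₀) ∧
          -- every trajectory is bounded, wherever it is defined, and returns to `K`
          ∀ (b : EReal) (μ : RemoteTracking.Vec p) (w wd : ℝ → RemoteTracking.Vec r)
            (wdm : ℕ → RemoteTracking.Vec r) (z : ℝ → RemoteTracking.Vec n) (y : ℝ → ℝ)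
            (ξ : ℝ → RemoteTracking.Vec d),
            RemoteTracking.IsTrajectory s f q yr φc (RemoteTracking.gainG κ c) k T N
              (RemoteTracking.Lseq W₀ N (M T)) b μ w wd wdm z y ξ →
            w 0 ∈ W₀ → (μ, wd 0, z 0, y 0, ξ 0) ∈ P ×ˢ W ×ˢ Z ×ˢ Y ×ˢ Ξ →
            (∀ t ∈ RemoteTracking.timeDomain b, (μ, wd t, z t, y t, ξ t) ∈ B) ∧
            ∀ ℓ : ℕ, (ℓ * T : ℝ) ∈ RemoteTracking.timeDomain b →
              (μ, wd (ℓ * T), z (ℓ * T), y (ℓ * T), ξ (ℓ * T)) ∈ K ∧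
              (1 ≤ ℓ → (μ, wdm ℓ, z (ℓ * T), y (ℓ * T), ξ (ℓ * T)) ∈ K) := by
  -- the internal model is input-to-state stable for every `κ > 0`; `1` is an arbitrary choice
  refine ⟨1, one_pos, fun κ hκ => ?_⟩
  obtain ⟨Ts, ks, Ym, Rξ, Bz, By, Bξ, hTs, hks, hYm, hRξ, hper⟩ :=
    RemoteTracking.exists_uniform_period_bounds hs hyr hf hq hW hWinv hP hY hΞ hstab
      hφc.continuous hφcs hc (zero_lt_one.trans_le hκ)
  refine ⟨Ts, ks, hTs, hks,
    P ×ˢ W ×ˢ Z ×ˢ Metric.closedBall 0 Ym ×ˢ Metric.closedBall 0 Rξ,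
    P ×ˢ W ×ˢ Metric.closedBall 0 Bz ×ˢ Metric.closedBall 0 By ×ˢ Metric.closedBall 0 Bξ,
    hP.prod (hW.prod (hZ.prod ((isCompact_closedBall _ _).prod (isCompact_closedBall _ _)))),
    hP.prod (hW.prod ((isCompact_closedBall _ _).prod
      ((isCompact_closedBall _ _).prod (isCompact_closedBall _ _)))), ?_, ?_, ?_⟩
  · rintro ⟨μ, w, z, y, ξ⟩ ⟨h1, h2, h3, h4, h5⟩
    exact ⟨h1, h2, h3, mem_closedBall_zero_iff.mpr (hYm y h4), mem_closedBall_zero_iff.mpr (hRξ ξ h5)⟩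
  · rintro ⟨μ, w, z, y, ξ⟩ ⟨h1, h2, h3, -, -⟩
    exact ⟨h1, h2, h3, mem_univ _, mem_univ _⟩
  intro T hT k hk N hN hmargin M hM hMN
  have hT0 : 0 ≤ T := hTs.le.trans hT.le
  have hMT : 0 ≤ M T := by
    have h := hM.1 (mem_Ici.mpr le_rfl) (mem_Ici.mpr hT0) hT0
    rw [hM.2.1] at h
    linarith
  have hreset : ∀ w : ℝ → RemoteTracking.Vec r, RemoteTracking.IsSolution s w → w 0 ∈ W₀ →
      ∀ ℓ : ℕ, ∀ v ∈ W, v + (RemoteTracking.Lseq W₀ N (M T) ℓ / N) •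
        RemoteTracking.quant N (RemoteTracking.Lseq W₀ N (M T) ℓ) (w (ℓ * T)) v ∈ W :=
    fun w hw hw0 ℓ v hv =>
      RemoteTracking.reset_mem hN hmargin (RemoteTracking.Lseq_mem_Icc W₀ hMT hMN ℓ)
        (hW₀inv.mem_of_isSolutionOn hs (hw.isSolutionOn (ℓ * T)) hw0
          ⟨by positivity, le_rfl⟩) hv
  refine ⟨?_, ?_⟩
  · intro w₀ hw₀ μ hμ wd₀ hwd₀ z₀ hz₀ y₀ hy₀ ξ₀ hξ₀
    obtain ⟨w, hw, hw0, -⟩ := hW₀inv w₀ hw₀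
    obtain ⟨wd, wdm, z, y, ξ, h⟩ := RemoteTracking.exists_isTrajectory
      (RemoteTracking.locallyLipschitz_loopField hs hyr hf hq hφc _ k μ) (hper k hk μ hμ) hW hTs hT hw
      (hreset w hw (hw0 ▸ hw₀)) (wd₀ := wd₀) (z₀ := z₀) (y₀ := y₀) (ξ₀ := ξ₀)
      ⟨hwd₀, hz₀, mem_closedBall_zero_iff.mpr (hYm y₀ hy₀), mem_closedBall_zero_iff.mpr (hRξ ξ₀ hξ₀)⟩
    exact ⟨w, wd, wdm, z, y, ξ, h.1, hw0, h.2⟩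
  · intro b μ w wd wdm z y ξ h hw0 h0
    obtain ⟨hμ, hwd0, hz0, hy0, hξ0⟩ := h0
    obtain ⟨h1, h2⟩ := h.bounds (hper k hk μ hμ) hW.isClosed hZ.isClosed hTs hT
      (hreset w h.exo hw0) hwd0 hz0 (hYm _ hy0) (hRξ _ hξ0)
    refine ⟨fun t ht => ?_, fun ℓ hℓ => ?_⟩
    · obtain ⟨h3, h4, h5, h6⟩ := h1 t ht
      exact ⟨hμ, h3, mem_closedBall_zero_iff.mpr h4, mem_closedBall_zero_iff.mpr h5,
        mem_closedBall_zero_iff.mpr h6⟩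
    · obtain ⟨h3, h4, h5, h6, h7⟩ := h2 ℓ hℓ
      have h8 : y (ℓ * T) ∈ Metric.closedBall 0 Ym := mem_closedBall_zero_iff.mpr h6
      have h9 := mem_closedBall_zero_iff.mpr h7
      exact ⟨⟨hμ, h3, h5, h8, h9⟩, fun hℓ1 => ⟨hμ, h4 hℓ1, h5, h8, h9⟩⟩
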